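/- **Theorem 1.2 (Extension problem for the logarithmic discrete Laplacian operator).** For $n\in\mathbb Z$ let $(\Delta_d f)(n)=f(n+1)-2f(n)+f(n-1)$. For $u>0$ and $m\in\mathbb Z$ let $p_u(m)=e^{-2u}I_{|m|}(2u)$ be the discrete heat kernel, where $I_k(x)=\sum_{j\ge 0}\frac{(x/2)^{2j+k}}{j!\,(j+k)!}$ is the modified Bessel function of the first kind, and put $p_u(f)(n)=\sum_{m\in\mathbb Z}p_u(n-m)f(m)$. Let $f:\mathbb Z\to\mathbb R$ satisfy $\sum_{m\in\mathbb Z}\frac{|f(m)|}{\sqrt{1+|m|}}<\infty$. For such $f$ the logarithmic discrete Laplacian is defined by $$(\log(-\Delta_d)f)(n)=\sum_{m\in\mathbb Z,\,m\ne n}W_0(n-m)\,(f(n)-f(m))-\sum_{m\in\mathbb Z}W_\infty(n-m)f(m)-\gamma f(n),\quad n\in\mathbb Z,$$ where $\gamma$ is the Euler--Mascheroni constant, $W_0(m)=\int_0^1\frac{p_t(m)}{t}\,dt$ for $m\neq 0$, and $W_\infty(m)=\int_1^\infty\frac{p_t(m)}{t}\,dt$ for $m\in\mathbb Z$; put also $$u_f(n,t)=\int_0^\infty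 p_u(f)(n)\,\frac{e^{-t^2/(4u)}}{u}\,du,\qquad n\in\mathbb Z,\ t>0.$$ All these series and integrals converge absolutely, $u_f(n,\cdot)$ is twice differentiable on $(0,\infty)$, and for every $n\in\mathbb Z$: (i) $\lim_{t\to\infty}u_f(n,t)=0$; (ii) $\big(\partial_t^2+\frac1t\partial_t+\Delta_d\big)u_f(n,t)=0$ for every $t>0$; (iii) $\lim_{t\to0^+}t\,\partial_tu_f(n,t)=-2f(n)$; (iv) $\lim_{t\to0^+}\frac{u_f(n,t)}{\log t}=-2f(n)$; (v) the limit $\lim_{t\to0^+}\big(u_f(n,t)+2f(n)\log t\big)$ exists in $\mathbb R$ and $$(\log(-\Delta_d)f)(n)=-\lim_{t\to0^+}\big(u_f(n,t)+2f(n)\log t\big)+K f(n),$$ where $K=-\gamma+\int_{1/4}^\infty\frac{e^{-v}}{v}\,dv-\int_0^{1/4}\frac{1-e^{-v}}{v}\,dv$. -/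

import Mathlib

open MeasureTheory Set Filter Topology

noncomputable section

namespace DiscreteLog

/-- The modified Bessel function of the first kind `I_k(x)` of nonnegative integer order `k`:
`I_k(x) = ∑_{j ≥ 0} (x/2)^(2j+k) / (j! (j+k)!)`. -/
def besselI (k : ℕ) (x : ℝ) : ℝ :=
  ∑' j : ℕ, (x / 2) ^ (2 * j + k) / ((j.factorial : ℝ) * ((j + k).factorial : ℝ))

/-- The heat kernel on `ℤ`: `p_u(m) = e^{-2u} I_{|m|}(2u)`. -/
def heatKernel (u : ℝ) (m : ℤ) : ℝ :=
  Real.exp (-2 * u) * besselI m.natAbs (2 * u)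

/-- `p_u(f)(n) = ∑_{m ∈ ℤ} p_u(n - m) f(m)`. -/
def heat (u : ℝ) (f : ℤ → ℝ) (n : ℤ) : ℝ :=
  ∑' m : ℤ, heatKernel u (n - m) * f m

/-- The discrete Laplacian `(Δ_d f)(n) = f(n+1) - 2 f(n) + f(n-1)`. -/
def discreteLaplacian (f : ℤ → ℝ) (n : ℤ) : ℝ :=
  f (n + 1) - 2 * f n + f (n - 1)

/-- `W_0(m) = ∫_0^1 p_t(m)/t dt` (finite for `m ≠ 0`, which are the only values used). -/
def kernelZero (m : ℤ) : ℝ :=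
  ∫ t in Ioc (0 : ℝ) 1, heatKernel t m / t

/-- `W_∞(m) = ∫_1^∞ p_t(m)/t dt`. -/
def kernelInfty (m : ℤ) : ℝ :=
  ∫ t in Ioi (1 : ℝ), heatKernel t m / t

/-- The logarithmic discrete Laplacian
`(log(-Δ_d) f)(n) = ∑_{m ≠ n} W_0(n-m) (f(n) - f(m)) - ∑_m W_∞(n-m) f(m) - γ f(n)`. -/
def logDiscreteLaplacian (f : ℤ → ℝ) (n : ℤ) : ℝ :=
  (∑' m : {m : ℤ // m ≠ n}, kernelZero (n - m) * (f n - f m))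
    - (∑' m : ℤ, kernelInfty (n - m) * f m)
    - Real.eulerMascheroniConstant * f n

/-- The integrand in `u` of the extension `u_f(n,t)`. -/
def extensionIntegrand (f : ℤ → ℝ) (n : ℤ) (t u : ℝ) : ℝ :=
  heat u f n * (Real.exp (-(t ^ 2 / (4 * u))) / u)

/-- The extension `u_f(n,t) = ∫_0^∞ p_u(f)(n) e^{-t²/(4u)}/u du`. -/
def extension (f : ℤ → ℝ) (n : ℤ) (t : ℝ) : ℝ :=
  ∫ u in Ioi (0 : ℝ), extensionIntegrand f n t u

/-- `K = -γ + ∫_{1/4}^∞ e^{-v}/v dv - ∫_0^{1/4} (1 - e^{-v})/v dv`. -/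
def constK : ℝ :=
  -Real.eulerMascheroniConstant
    + (∫ v in Ioi (1 / 4 : ℝ), Real.exp (-v) / v)
    - ∫ v in Ioc (0 : ℝ) (1 / 4), (1 - Real.exp (-v)) / v

end DiscreteLog

end

namespace DiscreteLog

/-! ### Moments of the exponential series -/

/-! Fix n and put h(u) = p_u(f)(n). The proof uses three facts about h: h' = Δ_d h
(`hasDerivAt_heat`), |h(u)| ≤ C u^(-1/8) (`exists_abs_heat_le`) and |h(u) - f(n)| ≤ D u
(`exists_abs_heat_sub_le`). They come from p_u being the law of the difference of two independent
Poisson(u) variables. Its mass is 1 and its variance 2u, so m² p_u(m) ≤ 2u, while bounds on binomial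
coefficients give p_u(m) ≤ (2u)^(-1/2). Interpolating the two yields p_u(m) √(1+|m|) ≤ 2 u^(-1/8),
which matches the weight in the hypothesis on f.

Write g_j(t,u) = e^(-t²/(4u))/u^j, so that u_f = ∫ h g_1. Since ∂_t g_j = -(t/2) g_(j+1), one gets
(∂_t² + (1/t)∂_t) g_1 = -g_2 + (t²/4) g_3 = ∂_u g_1. Integrating by parts in u moves ∂_u onto h, and
the heat equation gives (ii) (`integral_deriv_mul_gaussKernel`, `extension_pde`). Dominated
convergence gives (i). For (iii), t ∂_t u_f = -(t²/2) ∫ h g_2, and the scaling u = t² s turns this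
into -(1/2) ∫ h(t² s) g_2(1,s) ds, where g_2(1,·) has integral 4.

For (v), split at u = 1 and subtract f(n) on (0,1]. The regular parts converge to ∫_0^1 (h - f(n))/u
+ ∫_1^∞ h/u, which by Fubini are the W_0 and W_∞ sums up to sign. The singular part f(n) ∫_0^1 g_1
becomes f(n) ∫_{t²/4}^∞ e^(-v)/v dv, the source of -2 f(n) log t and of the constant K. Dividing by
log t gives (iv). -/

lemma hasSum_of_eq {ι : Type*} {f g : ι → ℝ} {a b : ℝ} (h : HasSum f a) (hfg : ∀ i, g i = f i)
    (hab : b = a) : HasSum g b := by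
  rw [hab, funext hfg]
  exact h

lemma hasSum_expTerm (u : ℝ) : HasSum (fun n : ℕ => u ^ n / (n.factorial : ℝ)) (Real.exp u) := by
  rw [Real.exp_eq_exp_ℝ]
  exact NormedSpace.expSeries_div_hasSum_exp u

lemma succ_mul_expTerm (u : ℝ) (n : ℕ) :
    ((n + 1 : ℕ) : ℝ) * (u ^ (n + 1) / ((n + 1).factorial : ℝ)) = u * (u ^ n / (n.factorial : ℝ)) := by
  rw [Nat.factorial_succ]
  have : (n.factorial : ℝ) ≠ 0 := by positivity
  have : ((n + 1 : ℕ) : ℝ) ≠ 0 := by positivity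
  push_cast at *
  field_simp
  ring

lemma hasSum_mul_expTerm (u : ℝ) :
    HasSum (fun n : ℕ => (n : ℝ) * (u ^ n / (n.factorial : ℝ))) (u * Real.exp u) := by
  have h := (hasSum_nat_add_iff (f := fun n : ℕ => (n : ℝ) * (u ^ n / (n.factorial : ℝ))) 1
    (g := u * Real.exp u)).1 ?_
  · simpa using h
  · simp_rw [succ_mul_expTerm]
    exact (hasSum_expTerm u).mul_left u

lemma hasSum_sq_mul_expTerm (u : ℝ) :
    HasSum (fun n : ℕ => (n : ℝ) ^ 2 * (u ^ n / (n.factorial : ℝ)))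
      ((u ^ 2 + u) * Real.exp u) := by
  have h := (hasSum_nat_add_iff (f := fun n : ℕ => (n : ℝ) ^ 2 * (u ^ n / (n.factorial : ℝ))) 1
    (g := (u ^ 2 + u) * Real.exp u)).1 ?_
  · simpa using h
  · have h1 := ((hasSum_mul_expTerm u).mul_left u).add ((hasSum_expTerm u).mul_left u)
    refine hasSum_of_eq h1 (fun n => ?_) ?_
    · rw [pow_two, mul_assoc, succ_mul_expTerm]
      push_cast
      ring
    · ring

/-- Shifted exponential series divided by u: up to e^u, the mean of 1/(N+1) for N Poisson, needed in
`besselI_le`. -/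
lemma hasSum_expTerm_div_succ {u : ℝ} (hu : 0 < u) :
    HasSum (fun n : ℕ => u ^ n / (n.factorial : ℝ) / ((n : ℝ) + 1))
      ((Real.exp u - 1) / u) := by
  have h := (hasSum_nat_add_iff' (f := fun n : ℕ => u ^ n / (n.factorial : ℝ)) 1).2
    (hasSum_expTerm u)
  have h2 := h.div_const u
  simp only [Finset.range_one, Finset.sum_singleton, pow_zero, Nat.factorial_zero, Nat.cast_one,
    div_one] at h2
  refine hasSum_of_eq h2 (fun n => ?_) rfl
  rw [Nat.factorial_succ]
  push_cast
  field_simp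
  ring

/-! ### The double exponential series -/

lemma expTerm_nonneg {u : ℝ} (hu : 0 ≤ u) (n : ℕ) : 0 ≤ u ^ n / (n.factorial : ℝ) := by
  positivity

lemma hasSum_mul_of_nonneg {f g : ℕ → ℝ} {a b : ℝ} (hf : HasSum f a) (hg : HasSum g b)
    (hf0 : ∀ n, 0 ≤ f n) (hg0 : ∀ n, 0 ≤ g n) :
    HasSum (fun x : ℕ × ℕ => f x.1 * g x.2) (a * b) :=
  hf.mul hg (hf.summable.mul_of_nonneg hg.summable hf0 hg0)

lemma hasSum_expTerm_mul {u : ℝ} (hu : 0 ≤ u) :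
    HasSum (fun x : ℕ × ℕ => u ^ x.1 / (x.1.factorial : ℝ) * (u ^ x.2 / (x.2.factorial : ℝ)))
      (Real.exp (2 * u)) := by
  rw [two_mul, Real.exp_add]
  exact hasSum_mul_of_nonneg (hasSum_expTerm u) (hasSum_expTerm u) (expTerm_nonneg hu)
    (expTerm_nonneg hu)

/-- Second moment of a difference of independent Poisson variables: expanding the square gives 2(u²
+ u) - 2u² = 2u. -/
lemma hasSum_sq_sub_mul_expTerm {u : ℝ} (hu : 0 ≤ u) :
    HasSum (fun x : ℕ × ℕ => ((x.1 : ℝ) - x.2) ^ 2 *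
      (u ^ x.1 / (x.1.factorial : ℝ) * (u ^ x.2 / (x.2.factorial : ℝ))))
      (2 * u * Real.exp (2 * u)) := by
  have h0 := hasSum_expTerm u
  have h1 := hasSum_mul_expTerm u
  have h2 := hasSum_sq_mul_expTerm u
  have p0 := expTerm_nonneg hu
  have p1 : ∀ n : ℕ, 0 ≤ (n : ℝ) * (u ^ n / (n.factorial : ℝ)) := fun n => by positivity
  have p2 : ∀ n : ℕ, 0 ≤ (n : ℝ) ^ 2 * (u ^ n / (n.factorial : ℝ)) := fun n => by positivity
  have a1 := hasSum_mul_of_nonneg h2 h0 p2 p0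
  have a2 := hasSum_mul_of_nonneg h0 h2 p0 p2
  have a3 := hasSum_mul_of_nonneg h1 h1 p1 p1
  refine hasSum_of_eq ((a1.add a2).sub (a3.mul_left 2)) (fun x => ?_) ?_
  · ring
  · rw [two_mul, Real.exp_add]
    ring

/-! ### The Bessel series -/

/-- The `j`-th term of the series of `I_k(2u)`. -/
noncomputable def besselTerm (u : ℝ) (k j : ℕ) : ℝ :=
  u ^ (2 * j + k) / ((j.factorial : ℝ) * ((j + k).factorial : ℝ))

lemma besselTerm_eq (u : ℝ) (k j : ℕ) :
    besselTerm u k j = u ^ (j + k) / ((j + k).factorial : ℝ) * (u ^ j / (j.factorial : ℝ)) := by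
  unfold besselTerm
  rw [div_mul_div_comm, ← pow_add, mul_comm ((j + k).factorial : ℝ)]
  congr 2
  ring

lemma besselTerm_nonneg {u : ℝ} (hu : 0 ≤ u) (k j : ℕ) : 0 ≤ besselTerm u k j := by
  unfold besselTerm
  positivity

lemma add_self_injective (k : ℕ) : Function.Injective (fun j : ℕ => (j + k, j)) :=
  fun _ _ h => (Prod.ext_iff.1 h).2

lemma summable_besselTerm {u : ℝ} (hu : 0 ≤ u) (k : ℕ) : Summable (besselTerm u k) := by
  refine ((hasSum_expTerm_mul hu).summable.comp_injective (add_self_injective k)).congr ?_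
  intro j
  exact (besselTerm_eq u k j).symm

lemma besselI_eq_tsum (u : ℝ) (k : ℕ) : besselI k (2 * u) = ∑' j, besselTerm u k j := by
  unfold besselI besselTerm
  simp

lemma hasSum_besselTerm {u : ℝ} (hu : 0 ≤ u) (k : ℕ) :
    HasSum (besselTerm u k) (besselI k (2 * u)) := by
  rw [besselI_eq_tsum]
  exact (summable_besselTerm hu k).hasSum

/-- Pairs of natural numbers are parametrized by their difference and their minimum. -/
def subMinEquiv : ℤ × ℕ ≃ ℕ × ℕ where
  toFun x := (x.2 + x.1.toNat, x.2 + (-x.1).toNat)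
  invFun y := ((y.1 : ℤ) - y.2, min y.1 y.2)
  left_inv x := by
    obtain ⟨m, j⟩ := x
    simp only [Prod.mk.injEq]
    constructor <;> omega
  right_inv y := by
    ext <;> simp <;> omega

lemma expTerm_mul_subMinEquiv (u : ℝ) (x : ℤ × ℕ) :
    u ^ (subMinEquiv x).1 / ((subMinEquiv x).1.factorial : ℝ) *
      (u ^ (subMinEquiv x).2 / ((subMinEquiv x).2.factorial : ℝ)) =
      besselTerm u x.1.natAbs x.2 := by
  obtain ⟨m, j⟩ := x
  rw [besselTerm_eq]
  rcases le_total 0 m with h | h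
  · have h1 : m.toNat = m.natAbs := by omega
    have h2 : (-m).toNat = 0 := by omega
    simp [subMinEquiv, h1, h2]
  · have h1 : m.toNat = 0 := by omega
    have h2 : (-m).toNat = m.natAbs := by omega
    simp [subMinEquiv, h1, h2, mul_comm]

/-- Summing e^u · e^u along the diagonals of ℕ × ℕ: the diagonal of difference m carries exactly the
series of I_|m|. -/
lemma hasSum_besselI {u : ℝ} (hu : 0 ≤ u) :
    HasSum (fun m : ℤ => besselI m.natAbs (2 * u)) (Real.exp (2 * u)) := by
  have h := (subMinEquiv.hasSum_iff (f := fun x : ℕ × ℕ =>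
    u ^ x.1 / (x.1.factorial : ℝ) * (u ^ x.2 / (x.2.factorial : ℝ)))).2 (hasSum_expTerm_mul hu)
  refine HasSum.prod_fiberwise h (fun m => ?_)
  simp only [Function.comp_apply, expTerm_mul_subMinEquiv]
  exact hasSum_besselTerm hu _

/-- Only one diagonal of the nonnegative second-moment series is kept. -/
lemma sq_mul_besselI_le {u : ℝ} (hu : 0 ≤ u) (k : ℕ) :
    (k : ℝ) ^ 2 * besselI k (2 * u) ≤ 2 * u * Real.exp (2 * u) := by
  have h := hasSum_sq_sub_mul_expTerm hu
  rw [besselI_eq_tsum, ← tsum_mul_left, ← h.tsum_eq]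
  refine Summable.tsum_le_tsum_of_inj _ (add_self_injective k) (fun c _ => by positivity)
    (fun j => ?_) ((summable_besselTerm hu k).mul_left _) h.summable
  rw [besselTerm_eq]
  push_cast
  exact le_of_eq (by ring)

/-! ### Binomial estimates and the uniform bound on I_k -/

lemma centralBinom_sq_mul_le (n : ℕ) : n.centralBinom ^ 2 * (2 * n + 1) ≤ (4 ^ n) ^ 2 := by
  induction n with
  | zero => simp
  | succ n ih =>
    have h := Nat.succ_mul_centralBinom_succ n
    have h1 : (n + 1) ^ 2 * ((n + 1).centralBinom ^ 2 * (2 * (n + 1) + 1)) ≤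
        (n + 1) ^ 2 * (4 ^ (n + 1)) ^ 2 := by
      calc (n + 1) ^ 2 * ((n + 1).centralBinom ^ 2 * (2 * (n + 1) + 1))
          = ((n + 1) * (n + 1).centralBinom) ^ 2 * (2 * (n + 1) + 1) := by ring
        _ = 4 * (n.centralBinom ^ 2 * (2 * n + 1)) * ((2 * n + 1) * (2 * n + 3)) := by
          rw [h]; ring
        _ ≤ 4 * (4 ^ n) ^ 2 * (4 * (n + 1) ^ 2) := by
          gcongr 4 * ?_ * ?_
          nlinarith
        _ = (n + 1) ^ 2 * (4 ^ (n + 1)) ^ 2 := by ring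
    exact Nat.le_of_mul_le_mul_left h1 (by positivity)

/-- The middle coefficient dominates; for N = 2n+1 it is half of the central coefficient of row
2n+2. -/
lemma choose_sq_mul_le (N j : ℕ) : N.choose j ^ 2 * (N + 1) ≤ (2 ^ N) ^ 2 := by
  rcases Nat.even_or_odd' N with ⟨n, rfl | rfl⟩
  · calc (2 * n).choose j ^ 2 * (2 * n + 1) ≤ n.centralBinom ^ 2 * (2 * n + 1) := by
          gcongr
          exact Nat.choose_le_centralBinom j n
      _ ≤ (4 ^ n) ^ 2 := centralBinom_sq_mul_le n
      _ = (2 ^ (2 * n)) ^ 2 := by rw [pow_mul]; norm_num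
  · have h1 : (2 * n + 1).choose j ≤ (2 * n + 1).choose n := by
      refine (Nat.choose_le_middle j (2 * n + 1)).trans (le_of_eq ?_)
      congr 1
      omega
    have h2 : (n + 1).centralBinom = 2 * (2 * n + 1).choose n := by
      rw [Nat.centralBinom_eq_two_mul_choose, show 2 * (n + 1) = (2 * n + 1) + 1 by ring,
        Nat.choose_succ_succ, Nat.choose_symm_half]
      ring
    have h3 := centralBinom_sq_mul_le (n + 1)
    rw [h2] at h3
    have h4 : (4 ^ (n + 1)) ^ 2 = 4 * (2 ^ (2 * n + 1)) ^ 2 := by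
      rw [show (4 : ℕ) ^ (n + 1) = 2 * 2 ^ (2 * n + 1) by rw [pow_succ 2, pow_mul]; ring]
      ring
    have h5 : (2 * n + 1).choose j ^ 2 * (2 * n + 1 + 1) ≤
        (2 * n + 1).choose n ^ 2 * (2 * (n + 1) + 1) := by
      gcongr
      omega
    nlinarith

lemma choose_div_two_pow_le (N j : ℕ) :
    (N.choose j : ℝ) / 2 ^ N ≤ 1 / Real.sqrt ((N : ℝ) + 1) := by
  have hs : 0 < Real.sqrt ((N : ℝ) + 1) := Real.sqrt_pos.2 (by positivity)
  rw [div_le_div_iff₀ (by positivity) hs, one_mul]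
  refine (sq_le_sq₀ (by positivity) (by positivity)).1 ?_
  rw [mul_pow, Real.sq_sqrt (by positivity)]
  exact_mod_cast choose_sq_mul_le N j

lemma besselTerm_eq_choose (u : ℝ) (k j : ℕ) :
    besselTerm u k j = (2 * u) ^ (2 * j + k) / ((2 * j + k).factorial : ℝ) *
      (((2 * j + k).choose j : ℝ) / 2 ^ (2 * j + k)) := by
  have h : (((2 * j + k).choose j : ℕ) : ℝ) =
      ((2 * j + k).factorial : ℝ) / ((j.factorial : ℝ) * ((j + k).factorial : ℝ)) := by
    rw [Nat.cast_choose ℝ (by omega : j ≤ 2 * j + k), show 2 * j + k - j = j + k by omega]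
  have : ((2 * j + k).factorial : ℝ) ≠ 0 := by positivity
  rw [h, besselTerm, mul_pow]
  field_simp

/-- Up to e^(2u), I_k(2u) is a partial Poisson(2u) average over N = 2j+k of binomial probabilities,
each at most 1/√(N+1). AM-GM with s = √(2u) replaces this by s/(2(N+1)) + 1/(2s), whose Poisson mean
is explicit. -/
lemma besselI_le {u : ℝ} (hu : 0 < u) (k : ℕ) :
    besselI k (2 * u) ≤ Real.exp (2 * u) / Real.sqrt (2 * u) := by
  set s := Real.sqrt (2 * u) with hs
  have hspos : 0 < s := Real.sqrt_pos.2 (by positivity)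
  have hss : s ^ 2 = 2 * u := Real.sq_sqrt (by positivity)
  have h1 := ((hasSum_expTerm_div_succ (u := 2 * u) (by positivity)).mul_left (s / 2)).add
    ((hasSum_expTerm (2 * u)).mul_left (1 / (2 * s)))
  have key : besselI k (2 * u) ≤
      s / 2 * ((Real.exp (2 * u) - 1) / (2 * u)) + 1 / (2 * s) * Real.exp (2 * u) := by
    rw [besselI_eq_tsum, ← h1.tsum_eq]
    refine Summable.tsum_le_tsum_of_inj (fun j => 2 * j + k) (fun a b h => by simpa using h)
      (fun c _ => by positivity) (fun j => ?_) (summable_besselTerm hu.le k) h1.summable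
    rw [besselTerm_eq_choose]
    generalize 2 * j + k = N
    have hr : 0 < Real.sqrt ((N : ℝ) + 1) := Real.sqrt_pos.2 (by positivity)
    have hrr : Real.sqrt ((N : ℝ) + 1) ^ 2 = N + 1 := Real.sq_sqrt (by positivity)
    have h2 : 1 / Real.sqrt ((N : ℝ) + 1) ≤ s / 2 / ((N : ℝ) + 1) + 1 / (2 * s) := by
      set r := Real.sqrt ((N : ℝ) + 1)
      rw [← hrr]
      have : s / 2 / r ^ 2 + 1 / (2 * s) - 1 / r = (s - r) ^ 2 / (2 * s * r ^ 2) := by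
        field_simp
        ring
      have h3 : 0 ≤ (s - r) ^ 2 / (2 * s * r ^ 2) := by positivity
      linarith
    calc (2 * u) ^ N / (N.factorial : ℝ) * ((N.choose j : ℝ) / 2 ^ N)
        ≤ (2 * u) ^ N / (N.factorial : ℝ) * (s / 2 / ((N : ℝ) + 1) + 1 / (2 * s)) := by
          gcongr
          exact (choose_div_two_pow_le N j).trans h2
      _ = _ := by ring
  refine key.trans ?_
  rw [← hss]
  have : s / 2 * ((Real.exp (s ^ 2) - 1) / s ^ 2) + 1 / (2 * s) * Real.exp (s ^ 2) =
      Real.exp (s ^ 2) / s - 1 / (2 * s) := by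
    field_simp
    ring
  rw [this]
  have : 0 < 1 / (2 * s) := by positivity
  linarith

/-! ### The derivative of the Bessel series -/

/-- The factor j kills the term j = 0, hence also the truncated exponent at j = k = 0. -/
lemma hasSum_shift_besselTerm {u : ℝ} (hu : 0 ≤ u) (k : ℕ) :
    HasSum (fun j : ℕ => (j : ℝ) * u ^ (2 * j + k - 1) / ((j.factorial : ℝ) * ((j + k).factorial : ℝ)))
      (besselI (k + 1) (2 * u)) := by
  have h := (hasSum_nat_add_iff (f := fun j : ℕ => (j : ℝ) * u ^ (2 * j + k - 1) /
    ((j.factorial : ℝ) * ((j + k).factorial : ℝ))) 1 (g := besselI (k + 1) (2 * u))).1 ?_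
  · simpa using h
  · refine hasSum_of_eq (hasSum_besselTerm hu (k + 1)) (fun j => ?_) rfl
    rw [besselTerm, show 2 * (j + 1) + k - 1 = 2 * j + (k + 1) by omega,
      show j + 1 + k = j + (k + 1) by ring, Nat.factorial_succ j]
    push_cast
    field_simp

/-- Termwise differentiation of the series of `I_{k+1}(2u)`. -/
lemma hasSum_deriv_besselTerm_succ {u : ℝ} (hu : 0 ≤ u) (k : ℕ) :
    HasSum (fun j : ℕ => ((2 * j + (k + 1) : ℕ) : ℝ) * u ^ (2 * j + (k + 1) - 1) /
      ((j.factorial : ℝ) * ((j + (k + 1)).factorial : ℝ)))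
      (besselI k (2 * u) + besselI (k + 2) (2 * u)) := by
  refine hasSum_of_eq ((hasSum_besselTerm hu k).add (hasSum_shift_besselTerm hu (k + 1))) (fun j => ?_) rfl
  rw [besselTerm, show 2 * j + (k + 1) - 1 = 2 * j + k by omega, ← add_assoc j k 1,
    Nat.factorial_succ (j + k)]
  push_cast
  field_simp
  ring

lemma hasSum_deriv_besselTerm_zero {u : ℝ} (hu : 0 ≤ u) :
    HasSum (fun j : ℕ => ((2 * j + 0 : ℕ) : ℝ) * u ^ (2 * j + 0 - 1) /
      ((j.factorial : ℝ) * ((j + 0).factorial : ℝ)))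
      (besselI 1 (2 * u) + besselI 1 (2 * u)) := by
  refine hasSum_of_eq ((hasSum_shift_besselTerm hu 0).add (hasSum_shift_besselTerm hu 0)) (fun j => ?_) rfl
  push_cast
  ring

/-- The differentiated terms increase in v, so on (0, u+1) they are dominated by their values at
u+1. -/
lemma hasDerivAt_besselI_of_hasSum {k : ℕ} {B : ℝ → ℝ}
    (hB : ∀ u : ℝ, 0 ≤ u → HasSum (fun j : ℕ => ((2 * j + k : ℕ) : ℝ) * u ^ (2 * j + k - 1) /
      ((j.factorial : ℝ) * ((j + k).factorial : ℝ))) (B u)) {u : ℝ} (hu : 0 < u) :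
    HasDerivAt (fun v => besselI k (2 * v)) (B u) u := by
  simp_rw [besselI_eq_tsum]
  rw [← (hB u hu.le).tsum_eq]
  refine hasDerivAt_tsum_of_isPreconnected (t := Ioo 0 (u + 1)) (y₀ := u)
    (g := fun j v => besselTerm v k j)
    (g' := fun j v => ((2 * j + k : ℕ) : ℝ) * v ^ (2 * j + k - 1) /
      ((j.factorial : ℝ) * ((j + k).factorial : ℝ)))
    (hB (u + 1) (by positivity)).summable isOpen_Ioo isPreconnected_Ioo (fun j v _ => ?_)
    (fun j v hv => ?_) ⟨hu, by linarith⟩ (summable_besselTerm hu.le k) ⟨hu, by linarith⟩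
  · simpa only [besselTerm] using (hasDerivAt_pow (2 * j + k) v).div_const _
  · have hv0 := hv.1
    rw [Real.norm_of_nonneg (by positivity)]
    gcongr
    exact hv.2.le

lemma hasDerivAt_besselI_succ (k : ℕ) {u : ℝ} (hu : 0 < u) :
    HasDerivAt (fun v => besselI (k + 1) (2 * v)) (besselI k (2 * u) + besselI (k + 2) (2 * u)) u :=
  hasDerivAt_besselI_of_hasSum (B := fun u => besselI k (2 * u) + besselI (k + 2) (2 * u))
    (fun _ hv => hasSum_deriv_besselTerm_succ hv k) hu

lemma hasDerivAt_besselI_zero {u : ℝ} (hu : 0 < u) :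
    HasDerivAt (fun v => besselI 0 (2 * v)) (besselI 1 (2 * u) + besselI 1 (2 * u)) u :=
  hasDerivAt_besselI_of_hasSum (B := fun u => besselI 1 (2 * u) + besselI 1 (2 * u))
    (fun _ hv => hasSum_deriv_besselTerm_zero hv) hu

/-! ### The heat kernel -/

lemma besselI_nonneg {u : ℝ} (hu : 0 ≤ u) (k : ℕ) : 0 ≤ besselI k (2 * u) := by
  rw [besselI_eq_tsum]
  exact tsum_nonneg (besselTerm_nonneg hu k)

lemma heatKernel_nonneg {u : ℝ} (hu : 0 ≤ u) (m : ℤ) : 0 ≤ heatKernel u m :=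
  mul_nonneg (Real.exp_pos _).le (besselI_nonneg hu _)

lemma hasSum_heatKernel {u : ℝ} (hu : 0 ≤ u) : HasSum (heatKernel u) 1 := by
  have h := (hasSum_besselI hu).mul_left (Real.exp (-2 * u))
  rwa [← Real.exp_add, show -2 * u + 2 * u = 0 by ring, Real.exp_zero] at h

lemma heatKernel_le_one {u : ℝ} (hu : 0 ≤ u) (m : ℤ) : heatKernel u m ≤ 1 :=
  le_hasSum (hasSum_heatKernel hu) m (fun i _ => heatKernel_nonneg hu i)

lemma sq_mul_heatKernel_le {u : ℝ} (hu : 0 ≤ u) (m : ℤ) :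
    (m : ℝ) ^ 2 * heatKernel u m ≤ 2 * u := by
  have h := sq_mul_besselI_le hu m.natAbs
  have h1 : ((m.natAbs : ℕ) : ℝ) ^ 2 = (m : ℝ) ^ 2 := by
    rw [Nat.cast_natAbs, Int.cast_abs, sq_abs]
  rw [h1] at h
  calc (m : ℝ) ^ 2 * heatKernel u m
      = Real.exp (-2 * u) * ((m : ℝ) ^ 2 * besselI m.natAbs (2 * u)) := by
        unfold heatKernel; ring
    _ ≤ Real.exp (-2 * u) * (2 * u * Real.exp (2 * u)) := by gcongr
    _ = 2 * u * Real.exp (-2 * u + 2 * u) := by rw [Real.exp_add]; ring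
    _ = 2 * u := by rw [show -2 * u + 2 * u = 0 by ring, Real.exp_zero, mul_one]

lemma heatKernel_le_inv_sqrt {u : ℝ} (hu : 0 < u) (m : ℤ) :
    heatKernel u m ≤ 1 / Real.sqrt (2 * u) := by
  calc heatKernel u m ≤ Real.exp (-2 * u) * (Real.exp (2 * u) / Real.sqrt (2 * u)) := by
        unfold heatKernel
        gcongr
        exact besselI_le hu _
    _ = Real.exp (-2 * u + 2 * u) / Real.sqrt (2 * u) := by rw [Real.exp_add]; ring
    _ = 1 / Real.sqrt (2 * u) := by rw [show -2 * u + 2 * u = 0 by ring, Real.exp_zero]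

/-- The Bessel recurrence supplies the two neighbours and the factor e^(-2u) the term -2. The sign
of m decides which neighbour has the smaller order; at m = 0 both have order 1. -/
lemma hasDerivAt_heatKernel {u : ℝ} (hu : 0 < u) (m : ℤ) :
    HasDerivAt (fun v => heatKernel v m) (discreteLaplacian (heatKernel u) m) u := by
  have he : HasDerivAt (fun v : ℝ => Real.exp (-2 * v)) (Real.exp (-2 * u) * (-2)) u := by
    simpa using ((hasDerivAt_id u).const_mul (-2)).exp
  have hb : HasDerivAt (fun v => besselI m.natAbs (2 * v))
      (besselI (m - 1).natAbs (2 * u) + besselI (m + 1).natAbs (2 * u)) u := by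
    rcases lt_trichotomy m 0 with h | h | h
    · obtain ⟨k, rfl⟩ : ∃ k : ℕ, m = -((k : ℤ) + 1) := ⟨(-m - 1).toNat, by omega⟩
      simp only [show (-((k : ℤ) + 1)).natAbs = k + 1 by omega,
        show (-((k : ℤ) + 1) - 1).natAbs = k + 2 by omega,
        show (-((k : ℤ) + 1) + 1).natAbs = k by omega]
      exact (hasDerivAt_besselI_succ k hu).congr_deriv (add_comm _ _)
    · subst h
      exact hasDerivAt_besselI_zero hu
    · obtain ⟨k, rfl⟩ : ∃ k : ℕ, m = (k : ℤ) + 1 := ⟨(m - 1).toNat, by omega⟩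
      rw [show ((k : ℤ) + 1).natAbs = k + 1 by omega,
        show ((k : ℤ) + 1 - 1).natAbs = k by omega,
        show ((k : ℤ) + 1 + 1).natAbs = k + 2 by omega]
      exact hasDerivAt_besselI_succ k hu
  refine (he.mul hb).congr_deriv ?_
  unfold discreteLaplacian heatKernel
  ring

/-! ### Decay of the heat kernel -/

/-- Interpolation: p⁸ m⁴ u = p⁶ (m² p)² u ≤ 4 (p² u)³, and p² u ≤ 1/2. The exponents are chosen so
that the powers of u cancel. -/
lemma heatKernel_pow_eight_mul_le {u : ℝ} (hu : 0 < u) (m : ℤ) :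
    heatKernel u m ^ 8 * (1 + |(m : ℝ)|) ^ 4 * u ≤ 8 := by
  have p0 := heatKernel_nonneg hu.le m
  have p1 := heatKernel_le_one hu.le m
  have hm := sq_mul_heatKernel_le hu.le m
  have hd : heatKernel u m ^ 2 * u ≤ 1 / 2 := by
    have h1 := pow_le_pow_left₀ p0 (heatKernel_le_inv_sqrt hu m) 2
    rw [div_pow, Real.sq_sqrt (by positivity), le_div_iff₀ (by positivity)] at h1
    linarith
  set p := heatKernel u m
  have ha : (1 + |(m : ℝ)|) ^ 4 ≤ 8 + 8 * (m : ℝ) ^ 4 := by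
    have h2 : (1 + |(m : ℝ)|) ^ 2 ≤ 2 + 2 * (m : ℝ) ^ 2 := by
      rw [← sq_abs (m : ℝ)]
      nlinarith [sq_nonneg (1 - |(m : ℝ)|)]
    calc (1 + |(m : ℝ)|) ^ 4 = ((1 + |(m : ℝ)|) ^ 2) ^ 2 := by ring
      _ ≤ (2 + 2 * (m : ℝ) ^ 2) ^ 2 := by gcongr
      _ ≤ 8 + 8 * (m : ℝ) ^ 4 := by nlinarith [sq_nonneg (1 - (m : ℝ) ^ 2)]
  calc p ^ 8 * (1 + |(m : ℝ)|) ^ 4 * u ≤ p ^ 8 * (8 + 8 * (m : ℝ) ^ 4) * u := by gcongr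
    _ = 8 * (p ^ 2 * u) * p ^ 6 + 8 * p ^ 6 * ((m : ℝ) ^ 2 * p) ^ 2 * u := by ring
    _ ≤ 8 * (1 / 2) * 1 + 8 * p ^ 6 * (2 * u) ^ 2 * u := by
      gcongr
      exact pow_le_one₀ p0 p1
    _ = 4 + 32 * (p ^ 2 * u) ^ 3 := by ring
    _ ≤ 4 + 32 * (1 / 2) ^ 3 := by gcongr
    _ = 8 := by norm_num

lemma heatKernel_mul_sqrt_le {u : ℝ} (hu : 0 < u) (m : ℤ) :
    heatKernel u m * Real.sqrt (1 + |(m : ℝ)|) ≤ 2 * u ^ (-(1 / 8) : ℝ) := by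
  have p0 := heatKernel_nonneg hu.le m
  refine (pow_le_pow_iff_left₀ (by positivity) (by positivity) (by norm_num : (8 : ℕ) ≠ 0)).1 ?_
  have h1 : (u ^ (-(1 / 8) : ℝ)) ^ 8 = u⁻¹ := by
    rw [← Real.rpow_natCast, ← Real.rpow_mul hu.le, ← Real.rpow_neg_one]
    norm_num
  have h2 : Real.sqrt (1 + |(m : ℝ)|) ^ 8 = (1 + |(m : ℝ)|) ^ 4 := by
    rw [show (8 : ℕ) = 2 * 4 by norm_num, pow_mul, Real.sq_sqrt (by positivity)]
  rw [mul_pow, mul_pow, h1, h2, ← div_eq_mul_inv, le_div_iff₀ hu]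
  exact (heatKernel_pow_eight_mul_le hu m).trans (by norm_num)

/-- Submultiplicativity of the weight, which trades growth in m for decay in n - m. -/
lemma sqrt_one_add_abs_le (n m : ℤ) : Real.sqrt (1 + |(m : ℝ)|) ≤
    Real.sqrt (1 + |(n : ℝ)|) * Real.sqrt (1 + |((n - m : ℤ) : ℝ)|) := by
  rw [← Real.sqrt_mul (by positivity)]
  refine Real.sqrt_le_sqrt ?_
  have h : |(m : ℝ)| ≤ |(n : ℝ)| + |((n - m : ℤ) : ℝ)| := by
    have := abs_sub (n : ℝ) ((n - m : ℤ) : ℝ)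
    push_cast at this ⊢
    simpa using this
  nlinarith [abs_nonneg (n : ℝ), abs_nonneg ((n - m : ℤ) : ℝ)]

lemma abs_heatKernel_mul_le (f : ℤ → ℝ) {u : ℝ} (hu : 0 < u) (n m : ℤ) :
    |heatKernel u (n - m) * f m| ≤
      2 * Real.sqrt (1 + |(n : ℝ)|) * u ^ (-(1 / 8) : ℝ) *
        (|f m| / Real.sqrt (1 + |(m : ℝ)|)) := by
  have hs : 0 < Real.sqrt (1 + |(m : ℝ)|) := Real.sqrt_pos.2 (by positivity)
  have p0 := heatKernel_nonneg hu.le (n - m)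
  rw [abs_mul, abs_of_nonneg p0]
  calc heatKernel u (n - m) * |f m|
      = heatKernel u (n - m) * Real.sqrt (1 + |(m : ℝ)|) *
        (|f m| / Real.sqrt (1 + |(m : ℝ)|)) := by field_simp
    _ ≤ heatKernel u (n - m) * (Real.sqrt (1 + |(n : ℝ)|) * Real.sqrt (1 + |((n - m : ℤ) : ℝ)|)) *
        (|f m| / Real.sqrt (1 + |(m : ℝ)|)) := by
      gcongr
      exact sqrt_one_add_abs_le n m
    _ = Real.sqrt (1 + |(n : ℝ)|) *
        (heatKernel u (n - m) * Real.sqrt (1 + |((n - m : ℤ) : ℝ)|)) *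
        (|f m| / Real.sqrt (1 + |(m : ℝ)|)) := by ring
    _ ≤ Real.sqrt (1 + |(n : ℝ)|) * (2 * u ^ (-(1 / 8) : ℝ)) *
        (|f m| / Real.sqrt (1 + |(m : ℝ)|)) := by
      gcongr ?_ * ?_ * ?_
      exact heatKernel_mul_sqrt_le hu _
    _ = _ := by ring

/-- A bound, summable in `m`, for `p_u(n - m) (f(m) - f(n)) / u`. -/
noncomputable def incrementBound (f : ℤ → ℝ) (n m : ℤ) : ℝ :=
  2 * |f n| * (1 / ((n - m : ℤ) : ℝ) ^ 2) +
    4 * Real.sqrt (1 + |(n : ℝ)|) * (|f m| / Real.sqrt (1 + |(m : ℝ)|))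

lemma abs_heatKernel_mul_sub_le (f : ℤ → ℝ) {u : ℝ} (hu : 0 < u) (n m : ℤ) :
    |heatKernel u (n - m) * (f m - f n)| ≤ u * incrementBound f n m := by
  have hs : 0 < Real.sqrt (1 + |(m : ℝ)|) := Real.sqrt_pos.2 (by positivity)
  have p0 := heatKernel_nonneg hu.le (n - m)
  rcases eq_or_ne m n with rfl | hmn
  · rw [sub_self (f m), mul_zero, abs_zero]
    unfold incrementBound
    positivity
  · have hk := sqrt_one_add_abs_le n m
    have hp := sq_mul_heatKernel_le hu.le (n - m)
    have hk1 : (1 : ℝ) ≤ |((n - m : ℤ) : ℝ)| := by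
      rw [← Int.cast_abs]
      exact_mod_cast Int.one_le_abs (sub_ne_zero.2 hmn.symm)
    set k : ℝ := ((n - m : ℤ) : ℝ)
    have hk2 : 0 < k ^ 2 := by
      rw [← sq_abs]
      positivity
    have hk3 : k ≠ 0 := fun h => by simp [h] at hk2
    have hp' : heatKernel u (n - m) ≤ 2 * u / k ^ 2 := by
      rw [le_div_iff₀ hk2]
      linarith
    -- Since |k| ≥ 1, the decay 2u/k² of the kernel absorbs the weight.
    have hsk : Real.sqrt (1 + |k|) ≤ 2 * k ^ 2 := by
      rw [Real.sqrt_le_left (by positivity), ← sq_abs k]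
      nlinarith [pow_le_pow_right₀ hk1 (show 1 ≤ 4 by norm_num),
        pow_le_pow_right₀ hk1 (show 0 ≤ 4 by norm_num)]
    have h1 : heatKernel u (n - m) * |f m| ≤
        u * (4 * Real.sqrt (1 + |(n : ℝ)|) * (|f m| / Real.sqrt (1 + |(m : ℝ)|))) := by
      calc heatKernel u (n - m) * |f m|
          = heatKernel u (n - m) * Real.sqrt (1 + |(m : ℝ)|) *
            (|f m| / Real.sqrt (1 + |(m : ℝ)|)) := by field_simp
        _ ≤ 2 * u / k ^ 2 * (Real.sqrt (1 + |(n : ℝ)|) * (2 * k ^ 2)) *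
            (|f m| / Real.sqrt (1 + |(m : ℝ)|)) := by
          gcongr
          exact hk.trans (by gcongr)
        _ = _ := by
          field_simp
          ring
    have h2 : heatKernel u (n - m) * |f n| ≤ u * (2 * |f n| * (1 / k ^ 2)) := by
      calc heatKernel u (n - m) * |f n| ≤ 2 * u / k ^ 2 * |f n| := by gcongr
        _ = _ := by ring
    rw [abs_mul, abs_of_nonneg p0]
    calc heatKernel u (n - m) * |f m - f n| ≤ heatKernel u (n - m) * (|f m| + |f n|) := by
          gcongr
          exact abs_sub _ _
      _ = heatKernel u (n - m) * |f n| + heatKernel u (n - m) * |f m| := by ring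
      _ ≤ _ := by
        rw [incrementBound, mul_add]
        exact add_le_add h2 h1

/-! ### The heat semigroup on functions of moderate growth -/

section heat

variable {f : ℤ → ℝ} (hf : Summable (fun m : ℤ => |f m| / Real.sqrt (1 + |(m : ℝ)|)))
include hf

lemma summable_incrementBound (n : ℤ) : Summable (incrementBound f n) := by
  refine Summable.add (Summable.mul_left _ ?_) (hf.mul_left _)
  have h : Summable (fun k : ℤ => 1 / (k : ℝ) ^ 2) :=
    Real.summable_one_div_int_pow.2 (by norm_num : 1 < 2)
  exact h.comp_injective (Equiv.subLeft n).injective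

lemma summable_heatKernel_mul {u : ℝ} (hu : 0 < u) (n : ℤ) :
    Summable (fun m : ℤ => heatKernel u (n - m) * f m) :=
  (hf.mul_left (2 * Real.sqrt (1 + |(n : ℝ)|) * u ^ (-(1 / 8) : ℝ))).of_norm_bounded
    (fun m => abs_heatKernel_mul_le f hu n m)

lemma hasSum_heat {u : ℝ} (hu : 0 < u) (n : ℤ) :
    HasSum (fun m : ℤ => heatKernel u (n - m) * f m) (heat u f n) :=
  (summable_heatKernel_mul hf hu n).hasSum

/-- The exponent -1/8 is integrable at 0 and, after division by u, at infinity. -/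
lemma exists_abs_heat_le (n : ℤ) :
    ∃ C : ℝ, 0 ≤ C ∧ ∀ u : ℝ, 0 < u → |heat u f n| ≤ C * u ^ (-(1 / 8) : ℝ) := by
  refine ⟨2 * Real.sqrt (1 + |(n : ℝ)|) * ∑' m : ℤ, |f m| / Real.sqrt (1 + |(m : ℝ)|),
    mul_nonneg (by positivity) (tsum_nonneg fun m => by positivity), fun u hu => ?_⟩
  have h := tsum_of_norm_bounded (f := fun m : ℤ => heatKernel u (n - m) * f m)
    (hf.hasSum.mul_left (2 * Real.sqrt (1 + |(n : ℝ)|) * u ^ (-(1 / 8) : ℝ)))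
    (fun m => abs_heatKernel_mul_le f hu n m)
  exact h.trans (le_of_eq (by ring))

lemma hasSum_heat_sub {u : ℝ} (hu : 0 < u) (n : ℤ) :
    HasSum (fun m : ℤ => heatKernel u (n - m) * (f m - f n)) (heat u f n - f n) := by
  have h1 : HasSum (fun m : ℤ => heatKernel u (n - m)) 1 :=
    (Equiv.subLeft n).hasSum_iff.2 (hasSum_heatKernel hu.le)
  refine hasSum_of_eq ((hasSum_heat hf hu n).sub (h1.mul_right (f n))) (fun m => ?_) (by ring)
  ring

/-- Because the kernel has mass 1, the difference is a sum of increments of f, each of size O(u)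
with summable constants. -/
lemma exists_abs_heat_sub_le (n : ℤ) :
    ∃ C : ℝ, 0 ≤ C ∧ ∀ u : ℝ, 0 < u → |heat u f n - f n| ≤ C * u := by
  have hb := summable_incrementBound hf n
  refine ⟨∑' m, incrementBound f n m, tsum_nonneg fun m => ?_, fun u hu => ?_⟩
  · unfold incrementBound
    positivity
  · rw [← (hasSum_heat_sub hf hu n).tsum_eq, mul_comm]
    exact tsum_of_norm_bounded (f := fun m : ℤ => heatKernel u (n - m) * (f m - f n)) (hb.hasSum.mul_left u)
      (fun m => abs_heatKernel_mul_sub_le f hu n m)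

lemma hasDerivAt_heat {u : ℝ} (hu : 0 < u) (n : ℤ) :
    HasDerivAt (fun v => heat v f n) (discreteLaplacian (heat u f) n) u := by
  have hsum : HasSum (fun m : ℤ => discreteLaplacian (heatKernel u) (n - m) * f m)
      (discreteLaplacian (heat u f) n) := by
    refine hasSum_of_eq (((hasSum_heat hf hu (n + 1)).sub ((hasSum_heat hf hu n).mul_left 2)).add
      (hasSum_heat hf hu (n - 1))) (fun m => ?_) rfl
    rw [discreteLaplacian, show n - m + 1 = n + 1 - m by ring, show n - m - 1 = n - 1 - m by ring]
    ring
  rw [← hsum.tsum_eq]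
  -- The bound u^(-1/8) decreases in u, so its value at u/2 dominates on all of (u/2, ∞).
  set A : ℤ → ℝ := fun k => 2 * Real.sqrt (1 + |(k : ℝ)|) * (u / 2) ^ (-(1 / 8) : ℝ) with hA
  have hle : ∀ v ∈ Ioi (u / 2), ∀ k m : ℤ, |heatKernel v (k - m) * f m| ≤
      A k * (|f m| / Real.sqrt (1 + |(m : ℝ)|)) := by
    intro v hv k m
    have hv' : u / 2 < v := hv
    refine (abs_heatKernel_mul_le f (by linarith) k m).trans ?_
    simp only [hA]
    gcongr ?_ * ?_ * ?_
    exact Real.rpow_le_rpow_of_nonpos (by positivity) hv'.le (by norm_num)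
  refine hasDerivAt_tsum_of_isPreconnected (t := Ioi (u / 2)) (y₀ := u)
    (g := fun m v => heatKernel v (n - m) * f m)
    (g' := fun m v => discreteLaplacian (heatKernel v) (n - m) * f m)
    (hf.mul_left (A (n + 1) + 2 * A n + A (n - 1)))
    isOpen_Ioi isPreconnected_Ioi (fun m v hv => ?_) (fun m v hv => ?_)
    (show u / 2 < u by linarith) (summable_heatKernel_mul hf hu n) (show u / 2 < u by linarith)
  · have hv' : u / 2 < v := hv
    exact (hasDerivAt_heatKernel (by linarith) (n - m)).mul_const _
  · have h1 := hle v hv (n + 1) m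
    have h2 := hle v hv n m
    have h3 := hle v hv (n - 1) m
    rw [discreteLaplacian, show n - m + 1 = n + 1 - m by ring, show n - m - 1 = n - 1 - m by ring,
      Real.norm_eq_abs, abs_le]
    rw [abs_le] at h1 h2 h3
    constructor <;> linarith

lemma continuousOn_heat (n : ℤ) : ContinuousOn (fun u => heat u f n) (Ioi 0) :=
  fun _ hu => (hasDerivAt_heat hf hu n).continuousAt.continuousWithinAt

end heat

lemma continuousOn_heatKernel (m : ℤ) : ContinuousOn (fun u => heatKernel u m) (Ioi 0) :=
  fun _ hu => (hasDerivAt_heatKernel hu m).continuousAt.continuousWithinAt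

/-! ### Integrals against `e^{-t²/(4u)} / u^j` -/

/-- The kernel `e^{-t²/(4u)} / u^j`. -/
noncomputable def gaussKernel (j : ℕ) (t u : ℝ) : ℝ :=
  Real.exp (-(t ^ 2 / (4 * u))) / u ^ j

lemma gaussKernel_nonneg (j : ℕ) (t : ℝ) {u : ℝ} (hu : 0 < u) : 0 ≤ gaussKernel j t u := by
  unfold gaussKernel
  positivity

lemma gaussKernel_le_inv_pow (j : ℕ) (t : ℝ) {u : ℝ} (hu : 0 < u) :
    gaussKernel j t u ≤ 1 / u ^ j := by
  unfold gaussKernel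
  gcongr
  exact Real.exp_le_one_iff.2 (neg_nonpos.2 (by positivity))

lemma gaussKernel_le_of_le (j : ℕ) {s t u : ℝ} (hu : 0 < u) (hs : 0 ≤ s) (hst : s ≤ t) :
    gaussKernel j t u ≤ gaussKernel j s u := by
  unfold gaussKernel
  gcongr

/-- The kernel is bounded in `u`, uniformly away from `t = 0`. -/
lemma exists_gaussKernel_le (j : ℕ) {t : ℝ} (ht : 0 < t) :
    ∃ C : ℝ, 0 ≤ C ∧ ∀ u : ℝ, 0 < u → gaussKernel j t u ≤ C := by
  -- The constant comes from x^j / j! ≤ e^x at x = t²/(4u).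
  refine ⟨j.factorial / (t ^ 2 / 4) ^ j, by positivity, fun u hu => ?_⟩
  have h := Real.pow_div_factorial_le_exp (t ^ 2 / (4 * u)) (by positivity) j
  unfold gaussKernel
  rw [Real.exp_neg, div_le_div_iff₀ (by positivity) (by positivity)]
  have h2 : (t ^ 2 / 4) ^ j = (t ^ 2 / (4 * u)) ^ j * u ^ j := by
    rw [← mul_pow]
    congr 1
    field_simp
  rw [div_le_iff₀ (by positivity)] at h
  rw [h2, inv_mul_le_iff₀ (Real.exp_pos _)]
  calc (t ^ 2 / (4 * u)) ^ j * u ^ j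
      ≤ (Real.exp (t ^ 2 / (4 * u)) * j.factorial) * u ^ j := by gcongr
    _ = _ := by ring

lemma continuousOn_gaussKernel (j : ℕ) (t : ℝ) : ContinuousOn (gaussKernel j t) (Ioi 0) := by
  unfold gaussKernel
  refine ContinuousOn.div ?_ (by fun_prop) (fun u hu => pow_ne_zero _ (ne_of_gt hu))
  refine Real.continuous_exp.comp_continuousOn (ContinuousOn.neg ?_)
  exact continuousOn_const.div (by fun_prop) (fun u hu => by
    have : (0 : ℝ) < u := hu
    positivity)

lemma continuousOn_rpow_Ioi (r : ℝ) : ContinuousOn (fun u : ℝ => u ^ r) (Ioi 0) :=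
  fun u hu => (Real.continuousAt_rpow_const u r (Or.inl (ne_of_gt hu))).continuousWithinAt

lemma rpow_mul_inv {u : ℝ} (hu : 0 < u) :
    u ^ (-(1 / 8) : ℝ) * (1 / u) = u ^ (-(9 / 8) : ℝ) := by
  rw [one_div u, ← Real.rpow_neg_one, ← Real.rpow_add hu]
  norm_num

/-- Near 0 the kernel is bounded; beyond 1 it is at most 1/u, leaving u^(-9/8). -/
lemma integrableOn_rpow_mul_gaussKernel {j : ℕ} (hj : 1 ≤ j) {t : ℝ} (ht : 0 < t) :
    IntegrableOn (fun u : ℝ => u ^ (-(1 / 8) : ℝ) * gaussKernel j t u) (Ioi 0) := by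
  have hc : ContinuousOn (fun u : ℝ => u ^ (-(1 / 8) : ℝ) * gaussKernel j t u) (Ioi 0) :=
    (continuousOn_rpow_Ioi _).mul (continuousOn_gaussKernel j t)
  obtain ⟨C, hC0, hC⟩ := exists_gaussKernel_le j ht
  rw [← Ioc_union_Ioi_eq_Ioi (zero_le_one' ℝ)]
  refine IntegrableOn.union ?_ ?_
  · have h1 : IntegrableOn (fun u : ℝ => u ^ (-(1 / 8) : ℝ)) (Ioc 0 1) :=
      (intervalIntegrable_iff_integrableOn_Ioc_of_le zero_le_one).1
        (intervalIntegral.intervalIntegrable_rpow' (by norm_num))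
    refine Integrable.mono' (h1.mul_const C)
      ((hc.mono Ioc_subset_Ioi_self).aestronglyMeasurable measurableSet_Ioc) ?_
    refine (ae_restrict_iff' measurableSet_Ioc).2 (Eventually.of_forall fun u hu => ?_)
    have hu0 : 0 < u := hu.1
    rw [Real.norm_of_nonneg (mul_nonneg (by positivity) (gaussKernel_nonneg j t hu0))]
    gcongr
    exact hC u hu0
  · have h1 : IntegrableOn (fun u : ℝ => u ^ (-(9 / 8) : ℝ)) (Ioi 1) :=
      integrableOn_Ioi_rpow_of_lt (by norm_num) one_pos
    refine Integrable.mono' h1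
      ((hc.mono (Ioi_subset_Ioi zero_le_one)).aestronglyMeasurable measurableSet_Ioi) ?_
    refine (ae_restrict_iff' measurableSet_Ioi).2 (Eventually.of_forall fun u hu => ?_)
    have hu1 : 1 < u := hu
    have hu0 : 0 < u := by linarith
    rw [Real.norm_of_nonneg (mul_nonneg (by positivity) (gaussKernel_nonneg j t hu0)),
      ← rpow_mul_inv hu0]
    gcongr
    refine (gaussKernel_le_inv_pow j t hu0).trans ?_
    gcongr
    exact le_self_pow₀ hu1.le (by omega)

lemma hasDerivAt_gaussKernel (j : ℕ) (t u : ℝ) :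
    HasDerivAt (fun s => gaussKernel j s u) (-(t / 2) * gaussKernel (j + 1) t u) t := by
  have h1 : HasDerivAt (fun s : ℝ => -(s ^ 2 / (4 * u))) (-(2 * t / (4 * u))) t := by
    exact (((hasDerivAt_pow 2 t).div_const (4 * u)).neg).congr_deriv (by simp)
  refine (h1.exp.div_const (u ^ j)).congr_deriv ?_
  unfold gaussKernel
  -- At u = 0 division by zero makes the kernel constant in t and the right side zero, so no
  -- positivity of u is needed.
  rcases eq_or_ne u 0 with rfl | hu
  · simp
  · field_simp
    ring

lemma hasDerivAt_gaussKernel_one_right (t : ℝ) {u : ℝ} (hu : 0 < u) :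
    HasDerivAt (gaussKernel 1 t) (-gaussKernel 2 t u + t ^ 2 / 4 * gaussKernel 3 t u) u := by
  have h1 : HasDerivAt (fun v : ℝ => -(t ^ 2 / (4 * v))) (t ^ 2 / (4 * u ^ 2)) u := by
    have h := ((hasDerivAt_inv hu.ne').const_mul (t ^ 2 / 4)).neg
    refine (h.congr_deriv ?_).congr_of_eventuallyEq (Eventually.of_forall fun v => ?_)
    · field_simp
    · simp only [Pi.neg_apply, mul_inv, div_eq_mul_inv]
      ring
  refine (h1.exp.div (hasDerivAt_pow 1 u) (by simpa using hu.ne')).congr_deriv ?_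
  unfold gaussKernel
  field_simp
  ring

section

variable {h : ℝ → ℝ} {C : ℝ} (hc : ContinuousOn h (Ioi 0))
  (hC : ∀ u : ℝ, 0 < u → |h u| ≤ C * u ^ (-(1 / 8) : ℝ))
include hc hC

lemma integrableOn_mul_gaussKernel {j : ℕ} (hj : 1 ≤ j) {t : ℝ} (ht : 0 < t) :
    IntegrableOn (fun u => h u * gaussKernel j t u) (Ioi 0) := by
  refine Integrable.mono' ((integrableOn_rpow_mul_gaussKernel hj ht).const_mul C)
    ((hc.mul (continuousOn_gaussKernel j t)).aestronglyMeasurable measurableSet_Ioi) ?_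
  refine (ae_restrict_iff' measurableSet_Ioi).2 (Eventually.of_forall fun u hu => ?_)
  have hu0 : 0 < u := hu
  have hg := gaussKernel_nonneg j t hu0
  rw [norm_mul, Real.norm_of_nonneg hg, ← mul_assoc]
  gcongr
  exact hC u hu0

lemma hasDerivAt_integral_mul_gaussKernel {j : ℕ} (hj : 1 ≤ j) {t : ℝ} (ht : 0 < t) :
    HasDerivAt (fun s => ∫ u in Ioi 0, h u * gaussKernel j s u)
      (-(t / 2) * ∫ u in Ioi 0, h u * gaussKernel (j + 1) t u) t := by
  have hmeas : ∀ (i : ℕ) (s : ℝ), AEStronglyMeasurable (fun u => h u * gaussKernel i s u)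
      (volume.restrict (Ioi 0)) := fun i s =>
    (hc.mul (continuousOn_gaussKernel i s)).aestronglyMeasurable measurableSet_Ioi
  have key := hasDerivAt_integral_of_dominated_loc_of_deriv_le
    (μ := volume.restrict (Ioi 0)) (x₀ := t) (s := Ioo (t / 2) (2 * t))
    (F := fun s u => h u * gaussKernel j s u)
    (F' := fun s u => -(s / 2) * (h u * gaussKernel (j + 1) s u))
    -- For s in (t/2, 2t): s/2 ≤ t, and the kernel decreases in s.
    (bound := fun u => t * (C * (u ^ (-(1 / 8) : ℝ) * gaussKernel (j + 1) (t / 2) u)))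
    (Ioo_mem_nhds (by linarith) (by linarith))
    (Eventually.of_forall fun s => hmeas j s) (integrableOn_mul_gaussKernel hc hC hj ht)
    ((hmeas (j + 1) t).const_mul _) ?_ ?_ ?_
  · have h2 := key.2
    rwa [integral_const_mul] at h2
  · refine (ae_restrict_iff' measurableSet_Ioi).2 (Eventually.of_forall fun u hu s hs => ?_)
    have hu0 : 0 < u := hu
    have hs0 : 0 < s := by linarith [hs.1]
    have hg := gaussKernel_nonneg (j + 1) s hu0
    have hCu := hC u hu0
    rw [norm_mul, norm_mul, norm_neg, Real.norm_of_nonneg hg, Real.norm_of_nonneg (by positivity),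
      Real.norm_eq_abs, ← mul_assoc C]
    gcongr
    · linarith [hs.2]
    · exact (abs_nonneg _).trans hCu
    · exact gaussKernel_le_of_le (j + 1) hu0 (by positivity) hs.1.le
  · exact ((integrableOn_rpow_mul_gaussKernel (by omega) (by positivity)).const_mul C).const_mul t
  · refine Eventually.of_forall fun u s _ => ?_
    exact ((hasDerivAt_gaussKernel j s u).const_mul (h u)).congr_deriv (by ring)

/-- Dominated convergence as `t → ∞`. -/
lemma tendsto_integral_mul_gaussKernel_atTop :
    Tendsto (fun t => ∫ u in Ioi 0, h u * gaussKernel 1 t u) atTop (𝓝 0) := by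
  have key := tendsto_integral_filter_of_dominated_convergence (μ := volume.restrict (Ioi 0))
    (l := atTop) (F := fun t u => h u * gaussKernel 1 t u) (f := fun _ => (0 : ℝ))
    (fun u => |h u * gaussKernel 1 1 u|) ?_ ?_
    (integrableOn_mul_gaussKernel hc hC le_rfl one_pos).abs ?_
  · simpa using key
  · exact Eventually.of_forall fun t =>
      (hc.mul (continuousOn_gaussKernel 1 t)).aestronglyMeasurable measurableSet_Ioi
  · filter_upwards [eventually_ge_atTop 1] with t ht
    refine (ae_restrict_iff' measurableSet_Ioi).2 (Eventually.of_forall fun u hu => ?_)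
    rw [Real.norm_eq_abs, abs_mul, abs_mul, abs_of_nonneg (gaussKernel_nonneg 1 t hu),
      abs_of_nonneg (gaussKernel_nonneg 1 1 hu)]
    gcongr
    exact gaussKernel_le_of_le 1 hu zero_le_one ht
  · refine (ae_restrict_iff' measurableSet_Ioi).2 (Eventually.of_forall fun u hu => ?_)
    have hu0 : (0 : ℝ) < u := hu
    have h1 : Tendsto (fun t : ℝ => t ^ 2 / (4 * u)) atTop atTop :=
      (tendsto_pow_atTop two_ne_zero).atTop_div_const (by positivity)
    have h2 := (Real.tendsto_exp_neg_atTop_nhds_zero.comp h1).div_const (u ^ 1)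
    simpa [gaussKernel] using h2.const_mul (h u)

/-- Integration by parts in `u`. -/
lemma integral_deriv_mul_gaussKernel {h' : ℝ → ℝ} {C' : ℝ} (hc' : ContinuousOn h' (Ioi 0))
    (hC' : ∀ u : ℝ, 0 < u → |h' u| ≤ C' * u ^ (-(1 / 8) : ℝ))
    (hd : ∀ u : ℝ, 0 < u → HasDerivAt h (h' u) u) {t : ℝ} (ht : 0 < t) :
    (∫ u in Ioi 0, h' u * gaussKernel 1 t u) - (∫ u in Ioi 0, h u * gaussKernel 2 t u)
      + t ^ 2 / 4 * (∫ u in Ioi 0, h u * gaussKernel 3 t u) = 0 := by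
  have i1 := integrableOn_mul_gaussKernel hc' hC' (le_refl 1) ht
  have i2 := integrableOn_mul_gaussKernel hc hC (show 1 ≤ 2 by norm_num) ht
  have i3 := integrableOn_mul_gaussKernel hc hC (show 1 ≤ 3 by norm_num) ht
  have hb : ∀ u : ℝ, 0 < u → ‖h u * gaussKernel 1 t u‖ ≤
      C * (u ^ (-(1 / 8) : ℝ) * gaussKernel 1 t u) := fun u hu => by
    have hg := gaussKernel_nonneg 1 t hu
    rw [norm_mul, Real.norm_of_nonneg hg, ← mul_assoc]
    gcongr
    exact hC u hu
  have hC0 : 0 ≤ C := by simpa using (abs_nonneg _).trans (hC 1 one_pos)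
  have key := integral_Ioi_of_hasDerivAt_of_tendsto (a := 0) (m := 0)
    (f := fun u => h u * gaussKernel 1 t u)
    (f' := fun u => h' u * gaussKernel 1 t u - h u * gaussKernel 2 t u
      + t ^ 2 / 4 * (h u * gaussKernel 3 t u)) ?_ ?_ ((i1.sub i2).add (i3.const_mul _)) ?_
  · have e : ∀ u, h' u * gaussKernel 1 t u - h u * gaussKernel 2 t u =
        ((fun u => h' u * gaussKernel 1 t u) - fun u => h u * gaussKernel 2 t u) u := fun _ => rfl
    simp_rw [e] at key
    rw [integral_add (i1.sub i2) (i3.const_mul _), integral_sub' i1 i2, integral_const_mul] at key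
    simpa [gaussKernel] using key
  · rw [← continuousWithinAt_Ioi_iff_Ici, ContinuousWithinAt]
    obtain ⟨D, hD0, hD⟩ := exists_gaussKernel_le 2 ht
    have h0 : h 0 * gaussKernel 1 t 0 = 0 := by simp [gaussKernel]
    rw [h0]
    have hlim : Tendsto (fun u : ℝ => C * (u ^ (7 / 8 : ℝ) * D)) (𝓝[>] 0) (𝓝 0) := by
      have h1 : Tendsto (fun u : ℝ => u ^ (7 / 8 : ℝ)) (𝓝[>] 0) (𝓝 0) := by
        have h2 := (Real.continuousAt_rpow_const 0 (7 / 8) (Or.inr (by norm_num))).tendsto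
        rw [Real.zero_rpow (by norm_num)] at h2
        exact h2.mono_left nhdsWithin_le_nhds
      simpa using (h1.mul_const D).const_mul C
    refine squeeze_zero_norm' ?_ hlim
    filter_upwards [self_mem_nhdsWithin] with u hu
    have hu0 : 0 < u := hu
    refine (hb u hu).trans ?_
    -- The extra factor u turns the bound u^(-1/8) into u^(7/8), so the boundary term at 0 vanishes.
    have h3 : gaussKernel 1 t u = u * gaussKernel 2 t u := by
      unfold gaussKernel
      field_simp
    have h4 : u ^ (7 / 8 : ℝ) = u ^ (-(1 / 8) : ℝ) * u := by
      rw [← Real.rpow_add_one hu0.ne']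
      norm_num
    rw [h3, h4, mul_assoc _ u D]
    gcongr
    exact hD u hu
  · intro u hu
    exact ((hd u hu).mul (hasDerivAt_gaussKernel_one_right t hu)).congr_deriv (by ring)
  · have hlim : Tendsto (fun u : ℝ => C * u ^ (-(9 / 8) : ℝ)) atTop (𝓝 0) := by
      simpa using (tendsto_rpow_neg_atTop (show (0 : ℝ) < 9 / 8 by norm_num)).const_mul C
    refine squeeze_zero_norm' ?_ hlim
    filter_upwards [eventually_gt_atTop 0] with u hu
    refine (hb u hu).trans ?_
    rw [← rpow_mul_inv hu]
    gcongr
    simpa using gaussKernel_le_inv_pow 1 t hu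

end

/-! ### Behaviour as `t → 0` -/

lemma integrableOn_gaussKernel_two {t : ℝ} (ht : 0 < t) :
    IntegrableOn (gaussKernel 2 t) (Ioi 0) := by
  have hc := continuousOn_gaussKernel 2 t
  obtain ⟨C, hC0, hC⟩ := exists_gaussKernel_le 2 ht
  rw [← Ioc_union_Ioi_eq_Ioi (zero_le_one' ℝ)]
  refine IntegrableOn.union ?_ ?_
  · refine Integrable.mono' (integrable_const C)
      ((hc.mono Ioc_subset_Ioi_self).aestronglyMeasurable measurableSet_Ioc) ?_
    refine (ae_restrict_iff' measurableSet_Ioc).2 (Eventually.of_forall fun u hu => ?_)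
    rw [Real.norm_of_nonneg (gaussKernel_nonneg 2 t hu.1)]
    exact hC u hu.1
  · refine Integrable.mono' (integrableOn_Ioi_rpow_of_lt (show (-2 : ℝ) < -1 by norm_num) one_pos)
      ((hc.mono (Ioi_subset_Ioi zero_le_one)).aestronglyMeasurable measurableSet_Ioi) ?_
    refine (ae_restrict_iff' measurableSet_Ioi).2 (Eventually.of_forall fun u hu => ?_)
    have hu0 : (0 : ℝ) < u := zero_lt_one.trans hu
    rw [Real.norm_of_nonneg (gaussKernel_nonneg 2 t hu0), Real.rpow_neg hu0.le]
    simpa using gaussKernel_le_inv_pow 2 t hu0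

lemma integral_gaussKernel_two : ∫ u in Ioi 0, gaussKernel 2 1 u = 4 := by
  have key := integral_Ioi_of_hasDerivAt_of_tendsto (a := 0) (m := 4)
    -- This is 4 e^(-1/(4u)) for u > 0. The factor u forces the value 0 at u = 0, where the bare
    -- exponential would take the value 1 and break continuity.
    (f := fun u => 4 * (u * gaussKernel 1 1 u)) (f' := gaussKernel 2 1) ?_ ?_
    (integrableOn_gaussKernel_two one_pos) ?_
  · simpa using key
  · rw [← continuousWithinAt_Ioi_iff_Ici, ContinuousWithinAt, zero_mul, mul_zero]
    obtain ⟨D, hD0, hD⟩ := exists_gaussKernel_le 1 one_pos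
    have hlim : Tendsto (fun u : ℝ => 4 * (u * D)) (𝓝[>] 0) (𝓝 0) := by
      have h1 : Tendsto (fun u : ℝ => 4 * (u * D)) (𝓝 0) (𝓝 (4 * (0 * D))) :=
        Continuous.tendsto (by fun_prop) 0
      rw [zero_mul, mul_zero] at h1
      exact h1.mono_left nhdsWithin_le_nhds
    refine squeeze_zero_norm' ?_ hlim
    filter_upwards [self_mem_nhdsWithin] with u hu
    have hu0 : 0 < u := hu
    have hg := gaussKernel_nonneg 1 1 hu0
    rw [Real.norm_of_nonneg (by positivity)]
    gcongr
    exact hD u hu0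
  · intro u hu
    have hu0 : 0 < u := hu
    refine (((hasDerivAt_id u).mul (hasDerivAt_gaussKernel_one_right 1 hu)).const_mul 4).congr_deriv
      ?_
    unfold gaussKernel
    simp only [id]
    field_simp
    ring
  · have h1 : Tendsto (fun u : ℝ => -(1 ^ 2 / (4 * u))) atTop (𝓝 (-0)) :=
      (tendsto_const_nhds.div_atTop (tendsto_id.const_mul_atTop (by norm_num : (0 : ℝ) < 4))).neg
    have h2 := ((Real.continuous_exp.tendsto (-0)).comp h1).const_mul 4
    rw [neg_zero, Real.exp_zero, mul_one] at h2
    refine h2.congr' ?_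
    filter_upwards [eventually_gt_atTop 0] with u hu
    simp only [gaussKernel, Function.comp_apply]
    field_simp

lemma sq_mul_integral_mul_gaussKernel_two (h : ℝ → ℝ) {t : ℝ} (ht : 0 < t) :
    t ^ 2 * ∫ u in Ioi 0, h u * gaussKernel 2 t u =
      ∫ s in Ioi 0, h (t ^ 2 * s) * gaussKernel 2 1 s := by
  have ht2 : 0 < t ^ 2 := by positivity
  have hcov := integral_comp_mul_left_Ioi (fun u => h u * gaussKernel 2 t u) 0 ht2
  rw [mul_zero, smul_eq_mul] at hcov
  have h1 : ∀ s : ℝ, h (t ^ 2 * s) * gaussKernel 2 1 s =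
      (t ^ 2) ^ 2 * (h (t ^ 2 * s) * gaussKernel 2 t (t ^ 2 * s)) := by
    intro s
    have h2 : t ^ 2 / (4 * (t ^ 2 * s)) = 1 ^ 2 / (4 * s) := by
      rw [one_pow, show 4 * (t ^ 2 * s) = t ^ 2 * (4 * s) by ring, ← div_div, div_self ht2.ne']
    unfold gaussKernel
    rw [h2, mul_pow]
    field_simp
  simp_rw [h1]
  rw [integral_const_mul, hcov]
  field_simp

/-- After the scaling u = t² s the kernel no longer depends on t, and h(t² s) → a boundedly. -/
lemma tendsto_sq_mul_integral_mul_gaussKernel_two {h : ℝ → ℝ} {M a : ℝ}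
    (hc : ContinuousOn h (Ioi 0)) (hM : ∀ u : ℝ, 0 < u → |h u| ≤ M)
    (ha : Tendsto h (𝓝[>] 0) (𝓝 a)) :
    Tendsto (fun t => t ^ 2 * ∫ u in Ioi 0, h u * gaussKernel 2 t u) (𝓝[>] 0) (𝓝 (4 * a)) := by
  have hlim : Tendsto (fun t : ℝ => ∫ s in Ioi 0, h (t ^ 2 * s) * gaussKernel 2 1 s) (𝓝[>] 0)
      (𝓝 (∫ s in Ioi 0, a * gaussKernel 2 1 s)) := by
    refine tendsto_integral_filter_of_dominated_convergence (fun s => M * gaussKernel 2 1 s)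
      ?_ ?_ ((integrableOn_gaussKernel_two one_pos).const_mul M) ?_
    · filter_upwards [self_mem_nhdsWithin] with t ht
      have ht0 : 0 < t := ht
      refine ContinuousOn.aestronglyMeasurable ?_ measurableSet_Ioi
      refine ContinuousOn.mul (hc.comp (by fun_prop) fun s hs => ?_) (continuousOn_gaussKernel 2 1)
      have hs0 : 0 < s := hs
      exact show 0 < t ^ 2 * s by positivity
    · filter_upwards [self_mem_nhdsWithin] with t ht
      have ht0 : 0 < t := ht
      refine (ae_restrict_iff' measurableSet_Ioi).2 (Eventually.of_forall fun s hs => ?_)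
      have hs0 : 0 < s := hs
      have hg := gaussKernel_nonneg 2 1 hs0
      rw [norm_mul, Real.norm_of_nonneg hg]
      gcongr
      exact hM _ (by positivity)
    · refine (ae_restrict_iff' measurableSet_Ioi).2 (Eventually.of_forall fun s hs => ?_)
      have hs0 : 0 < s := hs
      refine Tendsto.mul_const _ (ha.comp ?_)
      refine tendsto_nhdsWithin_iff.2 ⟨?_, ?_⟩
      · have h1 : Tendsto (fun t : ℝ => t ^ 2 * s) (𝓝 0) (𝓝 (0 ^ 2 * s)) :=
          Continuous.tendsto (by fun_prop) 0
        rw [zero_pow two_ne_zero, zero_mul] at h1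
        exact h1.mono_left nhdsWithin_le_nhds
      · filter_upwards [self_mem_nhdsWithin] with t ht
        have ht0 : 0 < t := ht
        exact show 0 < t ^ 2 * s by positivity
  rw [integral_const_mul, integral_gaussKernel_two, mul_comm] at hlim
  refine hlim.congr' ?_
  filter_upwards [self_mem_nhdsWithin] with t ht
  exact (sq_mul_integral_mul_gaussKernel_two h ht).symm

lemma tendsto_setIntegral_mul_gaussKernel_one {h : ℝ → ℝ} {S : Set ℝ} (hS : MeasurableSet S)
    (hS0 : S ⊆ Ioi 0) (hc : ContinuousOn h (Ioi 0)) (hi : IntegrableOn (fun u => h u / u) S) :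
    Tendsto (fun t => ∫ u in S, h u * gaussKernel 1 t u) (𝓝[>] 0) (𝓝 (∫ u in S, h u / u)) := by
  refine tendsto_integral_filter_of_dominated_convergence (fun u => |h u / u|) ?_ ?_ hi.abs ?_
  · exact Eventually.of_forall fun t =>
      ((hc.mul (continuousOn_gaussKernel 1 t)).mono hS0).aestronglyMeasurable hS
  · refine Eventually.of_forall fun t =>
      (ae_restrict_iff' hS).2 (Eventually.of_forall fun u hu => ?_)
    have hu0 : 0 < u := hS0 hu
    rw [norm_mul, Real.norm_of_nonneg (gaussKernel_nonneg 1 t hu0), abs_div, abs_of_pos hu0,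
      div_eq_mul_one_div, Real.norm_eq_abs]
    gcongr
    simpa using gaussKernel_le_inv_pow 1 t hu0
  · refine (ae_restrict_iff' hS).2 (Eventually.of_forall fun u hu => ?_)
    have h1 : Tendsto (fun t : ℝ => h u * gaussKernel 1 t u) (𝓝 0) (𝓝 (h u * gaussKernel 1 0 u)) :=
      ((hasDerivAt_gaussKernel 1 0 u).continuousAt.tendsto).const_mul _
    refine (h1.mono_left nhdsWithin_le_nhds).trans_eq ?_
    simp [gaussKernel, div_eq_mul_inv]

/-! ### The logarithmic singularity -/

lemma integrableOn_exp_neg_div {x : ℝ} (hx : 0 < x) :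
    IntegrableOn (fun v : ℝ => Real.exp (-v) / v) (Ioi x) := by
  have h1 := (exp_neg_integrableOn_Ioi x one_pos).mul_const (1 / x)
  refine Integrable.mono' h1 (Measurable.aestronglyMeasurable (by fun_prop)) ?_
  refine (ae_restrict_iff' measurableSet_Ioi).2 (Eventually.of_forall fun v hv => ?_)
  have hv' : x < v := hv
  have hv0 : 0 < v := hx.trans hv'
  rw [Real.norm_of_nonneg (by positivity), neg_one_mul, div_eq_mul_one_div]
  gcongr

lemma abs_one_sub_exp_neg_div_le {v : ℝ} (hv : 0 < v) : |(1 - Real.exp (-v)) / v| ≤ 1 := by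
  have h1 := Real.add_one_le_exp (-v)
  have h2 : Real.exp (-v) ≤ 1 := Real.exp_le_one_iff.2 (by linarith)
  rw [abs_of_nonneg (div_nonneg (by linarith) hv.le), div_le_one hv]
  linarith

lemma intervalIntegrable_one_sub_exp_neg_div {a b : ℝ} (ha : 0 ≤ a) (hab : a ≤ b) :
    IntervalIntegrable (fun v : ℝ => (1 - Real.exp (-v)) / v) volume a b := by
  rw [intervalIntegrable_iff_integrableOn_Ioc_of_le hab]
  refine Integrable.mono' (integrable_const 1) (Measurable.aestronglyMeasurable (by fun_prop)) ?_
  refine (ae_restrict_iff' measurableSet_Ioc).2 (Eventually.of_forall fun v hv => ?_)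
  exact abs_one_sub_exp_neg_div_le (ha.trans_lt hv.1)

/-- Decreasing substitution v = t²/(4u), under which du/u becomes dv/v up to sign. -/
lemma integral_gaussKernel_one_Ioc {t : ℝ} (ht : 0 < t) :
    ∫ u in Ioc 0 1, gaussKernel 1 t u = ∫ v in Ioi (t ^ 2 / 4), Real.exp (-v) / v := by
  have himg : (fun u : ℝ => t ^ 2 / (4 * u)) '' Ioc 0 1 = Ici (t ^ 2 / 4) := by
    ext v
    constructor
    · rintro ⟨u, hu, rfl⟩
      have hu0 : 0 < u := hu.1
      change t ^ 2 / 4 ≤ t ^ 2 / (4 * u)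
      refine div_le_div_of_nonneg_left (by positivity) (by positivity) ?_
      linarith [hu.2]
    · intro hv
      have hv' : t ^ 2 / 4 ≤ v := hv
      have hv0 : 0 < v := lt_of_lt_of_le (by positivity) hv'
      refine ⟨t ^ 2 / (4 * v), ⟨by positivity, ?_⟩, ?_⟩
      · rw [div_le_one (by positivity)]
        linarith
      · field_simp
  have key := integral_image_eq_integral_deriv_smul_of_antitoneOn (s := Ioc (0 : ℝ) 1)
    (f := fun u : ℝ => t ^ 2 / (4 * u)) (f' := fun u => -(t ^ 2 / (4 * u ^ 2)))
    measurableSet_Ioc ?_ ?_ (fun v => Real.exp (-v) / v)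
  · rw [himg, integral_Ici_eq_integral_Ioi] at key
    rw [key]
    refine setIntegral_congr_fun measurableSet_Ioc fun u hu => ?_
    have hu0 : 0 < u := hu.1
    simp only [gaussKernel, smul_eq_mul]
    field_simp
  · intro u hu
    have hu0 : 0 < u := hu.1
    have h := ((hasDerivAt_inv hu0.ne').const_mul (t ^ 2 / 4))
    refine ((h.congr_deriv ?_).congr_of_eventuallyEq
      (Eventually.of_forall fun v => ?_)).hasDerivWithinAt
    · field_simp
    · simp only [mul_inv, div_eq_mul_inv]
      ring
  · intro u hu v hv huv
    have hu0 : 0 < u := hu.1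
    refine div_le_div_of_nonneg_left (by positivity) (by positivity) ?_
    linarith

/-- On (x, 1/4], e^(-v)/v = 1/v - (1 - e^(-v))/v isolates the logarithm. With x = t²/4, the cut at
1/4 makes it exactly -2 log t. -/
lemma integral_exp_neg_div_Ioi {x : ℝ} (hx : 0 < x) (hx' : x ≤ 1 / 4) :
    ∫ v in Ioi x, Real.exp (-v) / v =
      (∫ v in Ioi (1 / 4 : ℝ), Real.exp (-v) / v) + Real.log (1 / 4 / x)
        - ((∫ v in Ioc (0 : ℝ) (1 / 4), (1 - Real.exp (-v)) / v)
          - ∫ v in (0 : ℝ)..x, (1 - Real.exp (-v)) / v) := by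
  have hi := integrableOn_exp_neg_div hx
  have hsplit : ∫ v in Ioi x, Real.exp (-v) / v =
      (∫ v in Ioc x (1 / 4), Real.exp (-v) / v) + ∫ v in Ioi (1 / 4 : ℝ), Real.exp (-v) / v := by
    rw [← setIntegral_union (Ioc_disjoint_Ioi le_rfl) measurableSet_Ioi
      (hi.mono_set Ioc_subset_Ioi_self) (hi.mono_set (Ioi_subset_Ioi hx')),
      Ioc_union_Ioi_eq_Ioi hx']
  have j1 := intervalIntegrable_one_sub_exp_neg_div (le_refl (0 : ℝ)) hx.le
  have j2 := intervalIntegrable_one_sub_exp_neg_div hx.le hx'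
  have hadd := intervalIntegral.integral_add_adjacent_intervals j1 j2
  have j3 : IntervalIntegrable (fun v : ℝ => 1 / v) volume x (1 / 4) := by
    refine ContinuousOn.intervalIntegrable ?_
    refine continuousOn_const.div continuousOn_id fun v hv => ?_
    rw [uIcc_of_le hx'] at hv
    exact (hx.trans_le hv.1).ne'
  have hlog : ∫ v in x..(1 / 4), 1 / v = Real.log (1 / 4 / x) :=
    integral_one_div_of_pos hx (by norm_num)
  have hsub := intervalIntegral.integral_sub j3 j2
  have hfun : ∀ v : ℝ, 1 / v - (1 - Real.exp (-v)) / v = Real.exp (-v) / v := fun v => by ring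
  simp_rw [hfun] at hsub
  rw [hsplit, ← intervalIntegral.integral_of_le hx', hsub, hlog,
    ← intervalIntegral.integral_of_le (by norm_num : (0 : ℝ) ≤ 1 / 4), ← hadd]
  ring

lemma tendsto_integral_gaussKernel_one_add_log :
    Tendsto (fun t => (∫ u in Ioc 0 1, gaussKernel 1 t u) + 2 * Real.log t) (𝓝[>] 0)
      (𝓝 ((∫ v in Ioi (1 / 4 : ℝ), Real.exp (-v) / v)
        - ∫ v in Ioc (0 : ℝ) (1 / 4), (1 - Real.exp (-v)) / v)) := by
  have hx : Tendsto (fun t : ℝ => t ^ 2 / 4) (𝓝[>] 0) (𝓝 0) := by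
    have h1 : Tendsto (fun t : ℝ => t ^ 2 / 4) (𝓝 0) (𝓝 (0 ^ 2 / 4)) :=
      Continuous.tendsto (by fun_prop) 0
    rw [zero_pow two_ne_zero, zero_div] at h1
    exact h1.mono_left nhdsWithin_le_nhds
  have hrem : Tendsto (fun t : ℝ => ∫ v in (0 : ℝ)..(t ^ 2 / 4), (1 - Real.exp (-v)) / v)
      (𝓝[>] 0) (𝓝 0) := by
    refine squeeze_zero_norm (fun t => ?_) hx
    have ht : (0 : ℝ) ≤ t ^ 2 / 4 := by positivity
    have h2 := intervalIntegral.norm_integral_le_of_norm_le_const (a := (0 : ℝ)) (b := t ^ 2 / 4)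
      (f := fun v : ℝ => (1 - Real.exp (-v)) / v) (C := 1) (fun v hv => by
        rw [uIoc_of_le ht] at hv
        exact abs_one_sub_exp_neg_div_le hv.1)
    rwa [one_mul, sub_zero, abs_of_nonneg ht] at h2
  have hlim := hrem.const_add ((∫ v in Ioi (1 / 4 : ℝ), Real.exp (-v) / v)
        - ∫ v in Ioc (0 : ℝ) (1 / 4), (1 - Real.exp (-v)) / v)
  rw [add_zero] at hlim
  refine hlim.congr' ?_
  filter_upwards [Ioo_mem_nhdsGT (zero_lt_one' ℝ)] with t ht
  have ht0 : 0 < t := ht.1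
  have hle : t ^ 2 / 4 ≤ 1 / 4 := by nlinarith [ht.2]
  have hlog : Real.log (1 / 4 / (t ^ 2 / 4)) = -(2 * Real.log t) := by
    rw [show 1 / 4 / (t ^ 2 / 4) = (t ^ 2)⁻¹ by field_simp, Real.log_inv, Real.log_pow]
    norm_num
  rw [integral_gaussKernel_one_Ioc ht0, integral_exp_neg_div_Ioi (by positivity) hle, hlog]
  ring

lemma integrableOn_div_Ioi_one {h : ℝ → ℝ} {C : ℝ} (hc : ContinuousOn h (Ioi 0))
    (hC : ∀ u : ℝ, 0 < u → |h u| ≤ C * u ^ (-(1 / 8) : ℝ)) :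
    IntegrableOn (fun u => h u / u) (Ioi 1) := by
  have h1 : IntegrableOn (fun u : ℝ => u ^ (-(9 / 8) : ℝ)) (Ioi 1) :=
    integrableOn_Ioi_rpow_of_lt (by norm_num) one_pos
  refine Integrable.mono' (h1.const_mul C) (ContinuousOn.aestronglyMeasurable
    ((hc.mono (Ioi_subset_Ioi zero_le_one)).div continuousOn_id
      fun u hu => (zero_lt_one.trans hu).ne') measurableSet_Ioi) ?_
  refine (ae_restrict_iff' measurableSet_Ioi).2 (Eventually.of_forall fun u hu => ?_)
  have hu0 : (0 : ℝ) < u := zero_lt_one.trans hu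
  rw [norm_div, Real.norm_of_nonneg hu0.le, ← rpow_mul_inv hu0, ← mul_assoc, div_eq_mul_one_div]
  gcongr
  exact hC u hu0

lemma integrableOn_div_Ioc_zero_one {h : ℝ → ℝ} {D : ℝ} (hc : ContinuousOn h (Ioi 0))
    (hD : ∀ u : ℝ, 0 < u → |h u| ≤ D * u) :
    IntegrableOn (fun u => h u / u) (Ioc 0 1) := by
  refine Integrable.mono' (integrable_const D) (ContinuousOn.aestronglyMeasurable
    ((hc.mono Ioc_subset_Ioi_self).div continuousOn_id fun u hu => hu.1.ne') measurableSet_Ioc) ?_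
  refine (ae_restrict_iff' measurableSet_Ioc).2 (Eventually.of_forall fun u hu => ?_)
  rw [norm_div, Real.norm_of_nonneg hu.1.le, div_le_iff₀ hu.1]
  exact hD u hu.1

lemma tendsto_integral_mul_gaussKernel_one_add_log {h : ℝ → ℝ} {C D a : ℝ}
    (hc : ContinuousOn h (Ioi 0)) (hC : ∀ u : ℝ, 0 < u → |h u| ≤ C * u ^ (-(1 / 8) : ℝ))
    (hD : ∀ u : ℝ, 0 < u → |h u - a| ≤ D * u) :
    Tendsto (fun t => (∫ u in Ioi 0, h u * gaussKernel 1 t u) + 2 * a * Real.log t) (𝓝[>] 0)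
      (𝓝 ((∫ u in Ioc 0 1, (h u - a) / u) + (∫ u in Ioi 1, h u / u)
        + a * ((∫ v in Ioi (1 / 4 : ℝ), Real.exp (-v) / v)
          - ∫ v in Ioc (0 : ℝ) (1 / 4), (1 - Real.exp (-v)) / v))) := by
  have hca : ContinuousOn (fun u => h u - a) (Ioi 0) := hc.sub continuousOn_const
  have l1 := tendsto_setIntegral_mul_gaussKernel_one measurableSet_Ioc Ioc_subset_Ioi_self hca
    (integrableOn_div_Ioc_zero_one hca hD)
  have l2 := tendsto_setIntegral_mul_gaussKernel_one measurableSet_Ioi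
    (Ioi_subset_Ioi zero_le_one) hc (integrableOn_div_Ioi_one hc hC)
  refine ((l1.add l2).add (tendsto_integral_gaussKernel_one_add_log.const_mul a)).congr' ?_
  filter_upwards [self_mem_nhdsWithin] with t ht
  have ht0 : 0 < t := ht
  have hi := integrableOn_mul_gaussKernel hc hC le_rfl ht0
  have hg : IntegrableOn (gaussKernel 1 t) (Ioc 0 1) := by
    obtain ⟨B, _, hB⟩ := exists_gaussKernel_le 1 ht0
    refine Integrable.mono' (integrable_const B) (((continuousOn_gaussKernel 1 t).mono
      Ioc_subset_Ioi_self).aestronglyMeasurable measurableSet_Ioc) ?_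
    refine (ae_restrict_iff' measurableSet_Ioc).2 (Eventually.of_forall fun u hu => ?_)
    rw [Real.norm_of_nonneg (gaussKernel_nonneg 1 t hu.1)]
    exact hB u hu.1
  have hsub : ∫ u in Ioc 0 1, (h u - a) * gaussKernel 1 t u =
      (∫ u in Ioc 0 1, h u * gaussKernel 1 t u) - a * ∫ u in Ioc 0 1, gaussKernel 1 t u := by
    rw [← integral_const_mul, ← integral_sub (hi.mono_set Ioc_subset_Ioi_self) (hg.const_mul a)]
    exact integral_congr_ae (Eventually.of_forall fun u => by ring)
  rw [hsub, ← Ioc_union_Ioi_eq_Ioi (zero_le_one' ℝ), setIntegral_union (Ioc_disjoint_Ioi le_rfl)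
    measurableSet_Ioi (hi.mono_set Ioc_subset_Ioi_self)
    (hi.mono_set (Ioi_subset_Ioi zero_le_one))]
  ring

/-! ### The kernels of the logarithmic Laplacian -/

lemma integrableOn_heatKernel_div_Ioc {m : ℤ} (hm : m ≠ 0) :
    IntegrableOn (fun t : ℝ => heatKernel t m / t) (Ioc 0 1) := by
  refine integrableOn_div_Ioc_zero_one (D := 2 / (m : ℝ) ^ 2) (continuousOn_heatKernel m)
    fun u hu => ?_
  have hm2 : 0 < (m : ℝ) ^ 2 := by positivity
  rw [abs_of_nonneg (heatKernel_nonneg hu.le m), div_mul_eq_mul_div, le_div_iff₀ hm2, mul_comm]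
  exact sq_mul_heatKernel_le hu.le m

lemma integrableOn_heatKernel_div_Ioi (m : ℤ) :
    IntegrableOn (fun t : ℝ => heatKernel t m / t) (Ioi 1) := by
  refine integrableOn_div_Ioi_one (C := 2) (continuousOn_heatKernel m) fun u hu => ?_
  have p0 := heatKernel_nonneg hu.le m
  rw [abs_of_nonneg p0]
  refine le_trans (le_mul_of_one_le_right p0 ?_) (heatKernel_mul_sqrt_le hu m)
  rw [Real.one_le_sqrt]
  linarith [abs_nonneg (m : ℝ)]

section

variable {f : ℤ → ℝ} (hf : Summable (fun m : ℤ => |f m| / Real.sqrt (1 + |(m : ℝ)|)))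
include hf

lemma hasSum_kernelZero (n : ℤ) :
    HasSum (fun m : ℤ => kernelZero (n - m) * (f n - f m))
      (∫ t in Ioc 0 1, -((heat t f n - f n) / t)) := by
  set F : ℤ → ℝ → ℝ := fun m t => heatKernel t (n - m) / t * (f n - f m)
  have hFi : ∀ m, Integrable (F m) (volume.restrict (Ioc 0 1)) := by
    intro m
    -- The diagonal is separate: p_t(0)/t is not integrable at 0, but the factor f(n) - f(m)
    -- vanishes there.
    rcases eq_or_ne m n with rfl | hmn
    · simp [F]
    · exact (integrableOn_heatKernel_div_Ioc (sub_ne_zero.2 hmn.symm)).mul_const _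
  have hFb : ∀ m, ∀ t ∈ Ioc (0 : ℝ) 1, ‖F m t‖ ≤ incrementBound f n m := by
    intro m t ht
    have h := abs_heatKernel_mul_sub_le f ht.1 n m
    rw [show F m t = -(heatKernel t (n - m) * (f m - f n)) / t by simp only [F]; ring,
      norm_div, norm_neg, Real.norm_of_nonneg ht.1.le, div_le_iff₀ ht.1, mul_comm (incrementBound f n m)]
    exact h
  have key := hasSum_integral_of_summable_integral_norm hFi
    ((summable_incrementBound hf n).of_nonneg_of_le (fun m => integral_nonneg fun _ => norm_nonneg _)
      fun m => ?_)
  · refine hasSum_of_eq key (fun m => ?_) ?_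
    · exact (integral_mul_const _ _).symm
    · refine setIntegral_congr_fun measurableSet_Ioc fun t ht => ?_
      have h := ((hasSum_heat_sub hf ht.1 n).div_const t).neg
      refine (hasSum_of_eq h (fun m => ?_) rfl).tsum_eq.symm
      simp only [F]
      ring
  · have h := setIntegral_mono_on (hFi m).norm
      (integrableOn_const (by simp) : IntegrableOn (fun _ => incrementBound f n m) (Ioc (0 : ℝ) 1))
      measurableSet_Ioc (hFb m)
    simpa using h

lemma hasSum_kernelInfty (n : ℤ) :
    HasSum (fun m : ℤ => kernelInfty (n - m) * f m) (∫ t in Ioi 1, heat t f n / t) := by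
  set F : ℤ → ℝ → ℝ := fun m t => heatKernel t (n - m) / t * f m
  have hFi : ∀ m, Integrable (F m) (volume.restrict (Ioi 1)) :=
    fun m => (integrableOn_heatKernel_div_Ioi (n - m)).mul_const _
  have hr : IntegrableOn (fun u : ℝ => u ^ (-(9 / 8) : ℝ)) (Ioi 1) :=
    integrableOn_Ioi_rpow_of_lt (by norm_num) one_pos
  set A := ∫ u in Ioi (1 : ℝ), u ^ (-(9 / 8) : ℝ)
  have key := hasSum_integral_of_summable_integral_norm hFi
    ((hf.mul_left (2 * Real.sqrt (1 + |(n : ℝ)|) * A)).of_nonneg_of_le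
      (fun m => integral_nonneg fun _ => norm_nonneg _) fun m => ?_)
  · refine hasSum_of_eq key (fun m => ?_) ?_
    · exact (integral_mul_const _ _).symm
    · refine setIntegral_congr_fun measurableSet_Ioi fun t ht => ?_
      have h := (hasSum_heat hf (zero_lt_one.trans ht) n).div_const t
      refine (hasSum_of_eq h (fun m => ?_) rfl).tsum_eq.symm
      simp only [F]
      ring
  · have h := setIntegral_mono_on (hFi m).norm
      (hr.const_mul (2 * Real.sqrt (1 + |(n : ℝ)|) * (|f m| / Real.sqrt (1 + |(m : ℝ)|))))
      measurableSet_Ioi fun t ht => ?_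
    · refine h.trans (le_of_eq ?_)
      rw [integral_const_mul]
      ring
    · have ht0 : (0 : ℝ) < t := zero_lt_one.trans ht
      have h := abs_heatKernel_mul_le f ht0 n m
      rw [show F m t = heatKernel t (n - m) * f m * (1 / t) by simp only [F]; ring,
        norm_mul, Real.norm_of_nonneg (one_div_pos.2 ht0).le, ← rpow_mul_inv ht0]
      calc ‖heatKernel t (n - m) * f m‖ * (1 / t)
          ≤ 2 * Real.sqrt (1 + |(n : ℝ)|) * t ^ (-(1 / 8) : ℝ) *
            (|f m| / Real.sqrt (1 + |(m : ℝ)|)) * (1 / t) := by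
            gcongr
            exact h
        _ = _ := by ring

lemma logDiscreteLaplacian_eq_integral (n : ℤ) :
    logDiscreteLaplacian f n = -(∫ t in Ioc 0 1, (heat t f n - f n) / t)
      - (∫ t in Ioi 1, heat t f n / t) - Real.eulerMascheroniConstant * f n := by
  have h : ∑' m : {m : ℤ // m ≠ n}, kernelZero (n - m) * (f n - f m) =
      ∑' m : ℤ, kernelZero (n - m) * (f n - f m) :=
    tsum_subtype_eq_of_support_subset (s := {m : ℤ | m ≠ n})
      (f := fun m : ℤ => kernelZero (n - m) * (f n - f m)) fun m hm hmn => hm (by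
        simp [show m = n from hmn])
  rw [logDiscreteLaplacian, h, (hasSum_kernelZero hf n).tsum_eq, (hasSum_kernelInfty hf n).tsum_eq,
    integral_neg]

/-! ### The extension -/

omit hf in
lemma extensionIntegrand_eq (n : ℤ) (t : ℝ) :
    extensionIntegrand f n t = fun u => heat u f n * gaussKernel 1 t u := by
  funext u
  rw [extensionIntegrand, gaussKernel, pow_one]

omit hf in
lemma extension_eq (n : ℤ) :
    extension f n = fun t => ∫ u in Ioi 0, heat u f n * gaussKernel 1 t u := by
  funext t
  rw [extension, extensionIntegrand_eq]

lemma hasDerivAt_extension (n : ℤ) {t : ℝ} (ht : 0 < t) :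
    HasDerivAt (extension f n) (-(t / 2) * ∫ u in Ioi 0, heat u f n * gaussKernel 2 t u) t := by
  obtain ⟨C, _, hC⟩ := exists_abs_heat_le hf n
  rw [extension_eq]
  exact hasDerivAt_integral_mul_gaussKernel (continuousOn_heat hf n) hC le_rfl ht

lemma hasDerivAt_deriv_extension (n : ℤ) {t : ℝ} (ht : 0 < t) :
    HasDerivAt (deriv (extension f n))
      (-(1 / 2) * (∫ u in Ioi 0, heat u f n * gaussKernel 2 t u)
        + t ^ 2 / 4 * ∫ u in Ioi 0, heat u f n * gaussKernel 3 t u) t := by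
  obtain ⟨C, _, hC⟩ := exists_abs_heat_le hf n
  have h2 := hasDerivAt_integral_mul_gaussKernel (continuousOn_heat hf n) hC
    (show 1 ≤ 2 by norm_num) ht
  have h1 : HasDerivAt (fun s : ℝ => -(s / 2)) (-(1 / 2)) t := ((hasDerivAt_id t).div_const 2).neg
  refine ((h1.mul h2).congr_deriv (by ring)).congr_of_eventuallyEq ?_
  filter_upwards [Ioi_mem_nhds ht] with s hs
  exact (hasDerivAt_extension hf n hs).deriv

lemma extension_pde (n : ℤ) {t : ℝ} (ht : 0 < t) :
    deriv (deriv (extension f n)) t + (1 / t) * deriv (extension f n) t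
      + discreteLaplacian (fun k : ℤ => extension f k t) n = 0 := by
  obtain ⟨C, _, hC⟩ := exists_abs_heat_le hf n
  obtain ⟨C₁, _, hC₁⟩ := exists_abs_heat_le hf (n + 1)
  obtain ⟨C₂, _, hC₂⟩ := exists_abs_heat_le hf (n - 1)
  have hc := continuousOn_heat hf n
  have hc₁ := continuousOn_heat hf (n + 1)
  have hc₂ := continuousOn_heat hf (n - 1)
  have ibp := integral_deriv_mul_gaussKernel hc hC
    (h' := fun u => discreteLaplacian (heat u f) n) (C' := C₁ + 2 * C + C₂)
    ((hc₁.sub (continuousOn_const.mul hc)).add hc₂)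
    (fun u hu => by
      have b := abs_le.1 (hC u hu)
      have b₁ := abs_le.1 (hC₁ u hu)
      have b₂ := abs_le.1 (hC₂ u hu)
      rw [discreteLaplacian, abs_le]
      constructor <;> linarith [b.1, b.2, b₁.1, b₁.2, b₂.1, b₂.2])
    (fun u hu => hasDerivAt_heat hf hu n) ht
  have i := integrableOn_mul_gaussKernel hc hC le_rfl ht
  have i₁ := integrableOn_mul_gaussKernel hc₁ hC₁ le_rfl ht
  have i₂ := integrableOn_mul_gaussKernel hc₂ hC₂ le_rfl ht
  have hlap : ∫ u in Ioi 0, discreteLaplacian (heat u f) n * gaussKernel 1 t u =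
      discreteLaplacian (fun k : ℤ => extension f k t) n := by
    simp only [discreteLaplacian, extension_eq]
    rw [← integral_const_mul, ← integral_sub i₁ (i.const_mul 2),
      ← integral_add (f := fun u => heat u f (n + 1) * gaussKernel 1 t u
        - 2 * (heat u f n * gaussKernel 1 t u)) (i₁.sub (i.const_mul 2)) i₂]
    exact integral_congr_ae (Eventually.of_forall fun u => by ring)
  rw [(hasDerivAt_deriv_extension hf n ht).deriv, (hasDerivAt_extension hf n ht).deriv, ← hlap]
  -- The second derivative and (1/t) times the first each contribute -1/2 to the coefficient of ∫ h
  -- g_2.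
  refine Eq.trans ?_ ibp
  field_simp
  ring

lemma tendsto_heat_zero (n : ℤ) : Tendsto (fun u => heat u f n) (𝓝[>] 0) (𝓝 (f n)) := by
  obtain ⟨D, _, hD⟩ := exists_abs_heat_sub_le hf n
  rw [tendsto_iff_norm_sub_tendsto_zero]
  have hlim : Tendsto (fun u : ℝ => D * u) (𝓝[>] 0) (𝓝 0) := by
    have h1 : Tendsto (fun u : ℝ => D * u) (𝓝 0) (𝓝 (D * 0)) := Continuous.tendsto (by fun_prop) 0
    rw [mul_zero] at h1
    exact h1.mono_left nhdsWithin_le_nhds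
  refine squeeze_zero' (Eventually.of_forall fun _ => norm_nonneg _) ?_ hlim
  filter_upwards [self_mem_nhdsWithin] with u hu
  exact hD u hu

/-- The linear estimate around f(n) controls u ≤ 1, the decay u^(-1/8) controls u ≥ 1. -/
lemma exists_abs_heat_le_const (n : ℤ) : ∃ M : ℝ, ∀ u : ℝ, 0 < u → |heat u f n| ≤ M := by
  obtain ⟨C, hC0, hC⟩ := exists_abs_heat_le hf n
  obtain ⟨D, hD0, hD⟩ := exists_abs_heat_sub_le hf n
  refine ⟨C + (|f n| + D), fun u hu => ?_⟩
  rcases le_total u 1 with h | h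
  · have h1 : |heat u f n| ≤ |f n| + |heat u f n - f n| := by
      simpa using abs_add_le (f n) (heat u f n - f n)
    have h2 : D * u ≤ D := mul_le_of_le_one_right hD0 h
    linarith [hD u hu]
  · have h1 : C * u ^ (-(1 / 8) : ℝ) ≤ C :=
      mul_le_of_le_one_right hC0 (Real.rpow_le_one_of_one_le_of_nonpos h (by norm_num))
    linarith [hC u hu, abs_nonneg (f n)]

lemma tendsto_mul_deriv_extension (n : ℤ) :
    Tendsto (fun t : ℝ => t * deriv (extension f n) t) (𝓝[>] 0) (𝓝 (-2 * f n)) := by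
  obtain ⟨M, hM⟩ := exists_abs_heat_le_const hf n
  have h := (tendsto_sq_mul_integral_mul_gaussKernel_two (continuousOn_heat hf n) hM
    (tendsto_heat_zero hf n)).const_mul (-(1 / 2))
  rw [show -(1 / 2) * (4 * f n) = -2 * f n by ring] at h
  refine h.congr' ?_
  filter_upwards [self_mem_nhdsWithin] with t ht
  rw [(hasDerivAt_extension hf n ht).deriv]
  ring

lemma tendsto_extension_add_log (n : ℤ) :
    Tendsto (fun t : ℝ => extension f n t + 2 * f n * Real.log t) (𝓝[>] 0)
      (𝓝 (f n * constK - logDiscreteLaplacian f n)) := by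
  obtain ⟨C, _, hC⟩ := exists_abs_heat_le hf n
  obtain ⟨D, _, hD⟩ := exists_abs_heat_sub_le hf n
  have h := tendsto_integral_mul_gaussKernel_one_add_log (continuousOn_heat hf n) hC hD
  rw [extension_eq]
  refine h.trans_eq ?_
  rw [logDiscreteLaplacian_eq_integral hf, constK]
  congr 1
  ring

lemma tendsto_extension_div_log (n : ℤ) :
    Tendsto (fun t : ℝ => extension f n t / Real.log t) (𝓝[>] 0) (𝓝 (-2 * f n)) := by
  have h := (tendsto_extension_add_log hf n).div_atBot Real.tendsto_log_nhdsGT_zero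
  have h2 := h.sub_const (2 * f n)
  rw [zero_sub, ← neg_mul] at h2
  refine h2.congr' ?_
  filter_upwards [Ioo_mem_nhdsGT (zero_lt_one' ℝ)] with t ht
  have hlog : Real.log t ≠ 0 := (Real.log_neg ht.1 ht.2).ne
  field_simp
  ring

end

end DiscreteLog

/-- The first two groups of conjuncts say that the extension and `log(-Δ_d) f` are given by
convergent series and integrals; then come the five properties of the extension. -/
theorem theorem1p2 (f : ℤ → ℝ)
    (hf : Summable (fun m : ℤ => |f m| / Real.sqrt (1 + |(m : ℝ)|))) :
    -- the extension is well defined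
    (∀ (n : ℤ) (u : ℝ), 0 < u →
        Summable (fun m : ℤ => DiscreteLog.heatKernel u (n - m) * f m)) ∧
    (∀ (n : ℤ) (t : ℝ), 0 < t →
        IntegrableOn (DiscreteLog.extensionIntegrand f n t) (Ioi 0)) ∧
    -- the logarithmic discrete Laplacian of `f` is well defined
    (∀ m : ℤ, m ≠ 0 →
        IntegrableOn (fun t : ℝ => DiscreteLog.heatKernel t m / t) (Ioc 0 1)) ∧
    (∀ m : ℤ, IntegrableOn (fun t : ℝ => DiscreteLog.heatKernel t m / t) (Ioi 1)) ∧
    (∀ n : ℤ, Summable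
        (fun m : {m : ℤ // m ≠ n} => DiscreteLog.kernelZero (n - m) * (f n - f m))) ∧
    (∀ n : ℤ, Summable (fun m : ℤ => DiscreteLog.kernelInfty (n - m) * f m)) ∧
    -- (i)
    (∀ n : ℤ, Tendsto (fun t : ℝ => DiscreteLog.extension f n t) atTop (𝓝 0)) ∧
    -- (ii)
    (∀ (n : ℤ) (t : ℝ), 0 < t →
        DifferentiableAt ℝ (DiscreteLog.extension f n) t ∧
        DifferentiableAt ℝ (deriv (DiscreteLog.extension f n)) t ∧
        deriv (deriv (DiscreteLog.extension f n)) t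
          + (1 / t) * deriv (DiscreteLog.extension f n) t
          + DiscreteLog.discreteLaplacian (fun k : ℤ => DiscreteLog.extension f k t) n = 0) ∧
    -- (iii)
    (∀ n : ℤ, Tendsto (fun t : ℝ => t * deriv (DiscreteLog.extension f n) t)
        (𝓝[>] 0) (𝓝 (-2 * f n))) ∧
    -- (iv)
    (∀ n : ℤ, Tendsto (fun t : ℝ => DiscreteLog.extension f n t / Real.log t)
        (𝓝[>] 0) (𝓝 (-2 * f n))) ∧
    -- (v)
    (∀ n : ℤ, ∃ L : ℝ,
        Tendsto (fun t : ℝ => DiscreteLog.extension f n t + 2 * f n * Real.log t)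
          (𝓝[>] 0) (𝓝 L) ∧
        DiscreteLog.logDiscreteLaplacian f n = -L + f n * DiscreteLog.constK) := by
  refine ⟨fun n u hu => DiscreteLog.summable_heatKernel_mul hf hu n, fun n t ht => ?_,
    fun m hm => DiscreteLog.integrableOn_heatKernel_div_Ioc hm,
    DiscreteLog.integrableOn_heatKernel_div_Ioi,
    fun n => (DiscreteLog.hasSum_kernelZero hf n).summable.subtype _,
    fun n => (DiscreteLog.hasSum_kernelInfty hf n).summable, fun n => ?_,
    fun n t ht => ⟨(DiscreteLog.hasDerivAt_extension hf n ht).differentiableAt,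
      (DiscreteLog.hasDerivAt_deriv_extension hf n ht).differentiableAt,
      DiscreteLog.extension_pde hf n ht⟩,
    DiscreteLog.tendsto_mul_deriv_extension hf, DiscreteLog.tendsto_extension_div_log hf,
    fun n => ⟨_, DiscreteLog.tendsto_extension_add_log hf n, by ring⟩⟩
  · obtain ⟨C, _, hC⟩ := DiscreteLog.exists_abs_heat_le hf n
    rw [DiscreteLog.extensionIntegrand_eq]
    exact DiscreteLog.integrableOn_mul_gaussKernel (DiscreteLog.continuousOn_heat hf n) hC le_rfl ht
  · obtain ⟨C, _, hC⟩ := DiscreteLog.exists_abs_heat_le hf n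
    rw [DiscreteLog.extension_eq]
    exact DiscreteLog.tendsto_integral_mul_gaussKernel_atTop (DiscreteLog.continuousOn_heat hf n) hC
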